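/- **Setting (the synchronous $\pi$-calculus $S\pi$).** Types are $1$, $\mathrm{sig}(t)$, $\mathrm{list}(t)$ and possibly further first-order inductive types; all names, variables, constructors and thread identifiers are typed and everything is well typed. Values are built from signal names by constructors, which include $*:1$, $\mathsf{nil}$ and $\mathsf{cons}$; patterns and expressions are built from variables (including signal names) by constructors. Programs are $$P::=0\mid A(\vec e)\mid \bar s e\mid s(x).P,K\mid [s_1=s_2]P_1,P_2\mid [u\unrhd p]P_1,P_2\mid \nu s\,P\mid P_1\,|\,P_2,\qquad K::=A(\vec r),$$ up to renaming of bound names, where $p$ is a constructor pattern binding all its variables in $P_1$, and $\vec r$ may contain dereferenced signals $!s$. Each identifier $A$ has one equation $A(\vec x)=P$ with $FV(P)\subseteq\{\vec x\}$; some identifier without parameters is defined as $0$ (so that $0$ can be used as a continuation $K$) and one is defined by $A()=A()$. Below, programs have no free variables except signal names; $fn$ denotes free signal names. *During an instant* the actions are $\alpha::=\tau\mid sv\mid \nu\vec t\,\bar s v$ (input; output extruding the set of names $\{\vec t\}$), and $\xrightarrow{\alpha}$ is generated by: $\bar s v\xrightarrow{\bar s v}\bar s v$; $\;s(x).P,K\xrightarrow{sv}[v/x]P\,|\,\bar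 s v$; $\;[s=s]P_1,P_2\xrightarrow{\tau}P_1$; $\;[s_1=s_2]P_1,P_2\xrightarrow{\tau}P_2$ if $s_1\ne s_2$; $\;[v\unrhd p]P_1,P_2\xrightarrow{\tau}\sigma P_1$ if $\sigma p=v$, and $\xrightarrow{\tau}P_2$ if $p$ does not match $v$; $\;A(\vec v)\xrightarrow{\tau}[\vec v/\vec x]P$ if $A(\vec x)=P$; and the usual $\pi$-calculus rules for parallel composition, synchronisation, restriction and scope extrusion. $\Rightarrow$ is the reflexive transitive closure of $\xrightarrow{\tau}$, and $\stackrel{\alpha}{\Rightarrow}$ is $\Rightarrow\xrightarrow{\alpha}\Rightarrow$ for $\alpha\ne\tau$. $P$ commits to emit on $s$, written $P\searrow\bar s$, if $P\xrightarrow{\nu\vec t\,\bar s v}P'$ for some $\vec t,v,P'$. *Suspension predicates:* $P\downarrow$ (suspension) if $P$ has no $\tau$-transition; $P\Downarrow$ (weak suspension) if $P\Rightarrow P'$ with $P'\downarrow$ for some $P'$; $P\Downarrow_L$ (L-suspension) if some finite sequence of transitions with arbitrary actions leads from $P$ to some $P'$ with $P'\downarrow$. *At the end of the instant:* for functions $E$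 from signal names to finite sets of values and $V$ from signal names to lists of values, the judgement $P\xrightarrow{E,V}P'$ is generated by: $0\xrightarrow{\emptyset,V}0$; $\;\bar s v\xrightarrow{[\{v\}/s],V}0$ if $v$ occurs in $V(s)$; $\;s(x).P,K\xrightarrow{\emptyset,V}V(K)$ if $V(s)=[\,]$, where $V(K)$ replaces each $!s'$ by $V(s')$; $\;P_1|P_2\xrightarrow{E_1\cup E_2,V}P_1'|P_2'$ if $P_i\xrightarrow{E_i,V}P_i'$ for $i=1,2$; $\;\nu s\,P\xrightarrow{E[\emptyset/s],V}\nu s\,P'$ if $P\xrightarrow{E,V'}P'$, $V'(s)$ enumerates $E(s)$ and $V,V'$ agree except on $s$ (bound names being distinct from each other and from the free names). Here a list enumerates a set if it contains exactly the elements of the set, each once. $P\mapsto P'$ means $P\xrightarrow{E,V}P'$ for some $E,V$ such that $V(s)$ enumerates $E(s)$ for every $s$. *Bisimulations.* Let $\phi$ be one of the predicates $\Downarrow_L,\Downarrow,\downarrow$, and let $\mathcal R$ be a symmetric relation on programs. $\mathcal R$ is a *labelled bisimulation* for $\phi$ if $P\mathrel{\mathcal R}Q$ implies: (L1) if $P\xrightarrow{\tau}P'$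 then $Q\Rightarrow Q'$ and $P'\mathrel{\mathcal R}Q'$ for some $Q'$; (L2) if $P\xrightarrow{\nu\vec t\,\bar s v}P'$, $\phi(P)$ and $\{\vec t\}\cap fn(Q)=\emptyset$ then $Q\stackrel{\nu\vec t\,\bar s v}{\Rightarrow}Q'$ and $P'\mathrel{\mathcal R}Q'$ for some $Q'$; (L3) if $P\xrightarrow{sv}P'$ then for some $Q'$ either $Q\stackrel{sv}{\Rightarrow}Q'$ and $P'\mathrel{\mathcal R}Q'$, or $Q\Rightarrow Q'$ and $P'\mathrel{\mathcal R}(Q'|\bar s v)$; (L4) if $S=\bar s_1v_1|\cdots|\bar s_nv_n$, $n\ge0$, $P'=(P|S)\downarrow$ and $P'\mapsto P''$, then $(Q|S)\Rightarrow Q'$, $Q'\downarrow$, $P'\mathrel{\mathcal R}Q'$, $Q'\mapsto Q''$ and $P''\mathrel{\mathcal R}Q''$ for some $Q',Q''$. $\mathcal R$ is a *barbed bisimulation* for $\phi$ if $P\mathrel{\mathcal R}Q$ implies: (B1) the same as (L1); (B2) if $P\searrow\bar s$ and $\phi(P)$ then $Q\Rightarrow Q'$, $Q'\searrow\bar s$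 and $P\mathrel{\mathcal R}Q'$ for some $Q'$; (B3) if $P\downarrow$ and $P\mapsto P''$ then $Q\Rightarrow Q'$, $Q'\downarrow$, $P\mathrel{\mathcal R}Q'$, $Q'\mapsto Q''$ and $P''\mathrel{\mathcal R}Q''$ for some $Q',Q''$. It is a *contextual bisimulation* for $\phi$ if moreover $P\mathrel{\mathcal R}Q$ implies $C[P]\mathrel{\mathcal R}C[Q]$ for every static context $C::=[\,]\mid C|P\mid\nu s\,C$. Let $\approx_L,\approx_B,\approx_C$ be the largest labelled, barbed and contextual bisimulation for $\phi={\Downarrow_L}$; write $\approx^{wsusp}_X$ for the variant with $\phi={\Downarrow}$ and $\approx^{susp}_X$ for the variant with $\phi={\downarrow}$ ($X=L,B,C$). **Proposition (comparing bisimulations).** (1) With strict inclusions for barbed and labelled bisimulation, $$\approx_B\ \subsetneq\ \approx_B^{wsusp}\ \subsetneq\ \approx_B^{susp},\qquad \approx_L\ \subsetneq\ \approx_L^{wsusp}\ \subsetneq\ \approx_L^{susp},\qquad \approx_C\ \subseteq\ \approx_C^{wsusp}\ \subseteq\ \approx_C^{susp}.$$ (2) None of the barbed bisimulations $\approx_B,\approx_B^{wsusp},\approx_B^{susp}$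 and none of the labelled bisimulations $\approx_L^{wsusp},\approx_L^{susp}$ is preserved by parallel composition: for each of these relations $\approx$ there are programs $P,Q,R$ with $P\approx Q$ but not $(P|R)\approx(Q|R)$. -/

import Mathlib

namespace SPi

/-! ## Types, signatures and terms -/

/-- First-order types: the unit type `1`, signals carrying values of a type, lists, and further
inductive types named by the elements of `B`. -/
inductive Ty (B : Type) : Type
  | one : Ty B
  | sig : Ty B → Ty B
  | list : Ty B → Ty B
  | base : B → Ty B

/-- The parameters of the calculus: further inductive types with their constructors, and the
thread identifiers, all of them with their types. -/
structure Signature where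
  Base : Type
  Cnst : Type
  cnstArgs : Cnst → List (Ty Base)
  cnstRes : Cnst → Base
  Ident : Type
  params : Ident → List (Ty Base)

/-- The types over a signature. -/
abbrev Signature.T (S : Signature) : Type := Ty S.Base

/-- Typing contexts of the bound variables (nearest binder first). -/
abbrev Signature.Cx (S : Signature) : Type := List S.T

/-- A signal name `(t, n)`: the `n`-th signal name of type `sig t`. Names come with their types. -/
abbrev Signature.Name (S : Signature) : Type := S.T × ℕ

/-- `Var Γ t`: the positions of `t` in `Γ`, that is, typed de Bruijn variables. -/
inductive Var {T : Type} : List T → T → Type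
  | zero {Γ : List T} {t : T} : Var (t :: Γ) t
  | succ {Γ : List T} {t u : T} : Var Γ t → Var (u :: Γ) t

/-- Typed constructors. -/
inductive Con (S : Signature) : S.Cx → S.T → Type
  | star : Con S [] .one
  | nil (t : S.T) : Con S [] (.list t)
  | cons (t : S.T) : Con S [t, .list t] (.list t)
  | other (c : S.Cnst) : Con S (S.cnstArgs c) (.base (S.cnstRes c))

/-- Expressions: terms built from constructors, signal names and (bound) variables. Vectors
`e₁, …, eₙ` of expressions of types `t₁, …, tₙ` are families indexed by `Var [t₁, …, tₙ]`. -/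
inductive Term (S : Signature) (Γ : S.Cx) : S.T → Type
  | var {t : S.T} (x : Var Γ t) : Term S Γ t
  | name {t : S.T} (n : ℕ) : Term S Γ (.sig t)
  | con {ts : S.Cx} {t : S.T} (c : Con S ts t) (args : ∀ u : S.T, Var ts u → Term S Γ u) :
      Term S Γ t

/-- Values: expressions without variables other than signal names. -/
abbrev Val (S : Signature) (t : S.T) : Type := Term S [] t

/-- Patterns. All variables of a pattern (signal names included) are bound by the matching
construct, and are the variables of the context `D`. -/
inductive Pat (S : Signature) (D : S.Cx) : S.T → Type
  | var {t : S.T} (x : Var D t) : Pat S D t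
  | con {ts : S.Cx} {t : S.T} (c : Con S ts t) (args : ∀ u : S.T, Var ts u → Pat S D u) :
      Pat S D t

/-- The variable `x` occurs in a pattern. -/
inductive Pat.Occurs {S : Signature} {D : S.Cx} {w : S.T} (x : Var D w) :
    ∀ {t : S.T}, Pat S D t → Prop
  | var : Pat.Occurs x (.var x)
  | con {ts : S.Cx} {t : S.T} (c : Con S ts t) (args : ∀ u : S.T, Var ts u → Pat S D u)
      {u : S.T} (y : Var ts u) : Pat.Occurs x (args u y) → Pat.Occurs x (.con c args)

/-- Expressions with dereferenciation; `deref s` is `!s`. -/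
inductive Rexp (S : Signature) (Γ : S.Cx) : S.T → Type
  | deref {t : S.T} (s : Term S Γ (.sig t)) : Rexp S Γ (.list t)
  | var {t : S.T} (x : Var Γ t) : Rexp S Γ t
  | name {t : S.T} (n : ℕ) : Rexp S Γ (.sig t)
  | con {ts : S.Cx} {t : S.T} (c : Con S ts t) (args : ∀ u : S.T, Var ts u → Rexp S Γ u) :
      Rexp S Γ t

/-! ## Programs -/

/-- Well-typed programs with bound variables in `Γ`, up to renaming of bound variables:
* `zero` is the terminated thread `0`;
* `call A e` is `A(e)`;
* `emit s e` is the emission of `e` on `s`;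
* `present s P A r` is `s(x).P, K` with `K = A(r)`;
* `ifEq s₁ s₂ P₁ P₂` is `[s₁ = s₂] P₁, P₂`;
* `ifMatch u c p _ P₁ P₂` is `[u ⊵ c(p)] P₁, P₂`, where `D` consists of exactly the variables that
  occur in the pattern `c(p)`; they are bound in `P₁`;
* `nu P` is `ν s P`;
* `par P₁ P₂` is `P₁ ∣ P₂`. -/
inductive Prog (S : Signature) : S.Cx → Type
  | zero {Γ : S.Cx} : Prog S Γ
  | call {Γ : S.Cx} (A : S.Ident) (e : ∀ u : S.T, Var (S.params A) u → Term S Γ u) : Prog S Γ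
  | emit {Γ : S.Cx} {t : S.T} (s : Term S Γ (.sig t)) (e : Term S Γ t) : Prog S Γ
  | present {Γ : S.Cx} {t : S.T} (s : Term S Γ (.sig t)) (P : Prog S (t :: Γ))
      (A : S.Ident) (r : ∀ u : S.T, Var (S.params A) u → Rexp S Γ u) : Prog S Γ
  | ifEq {Γ : S.Cx} {t : S.T} (s₁ s₂ : Term S Γ (.sig t)) (P₁ P₂ : Prog S Γ) : Prog S Γ
  | ifMatch {Γ : S.Cx} {t : S.T} {D ts : S.Cx} (u : Term S Γ t) (c : Con S ts t)
      (p : ∀ w : S.T, Var ts w → Pat S D w)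
      (hp : ∀ (w : S.T) (x : Var D w), Pat.Occurs x (Pat.con c p))
      (P₁ : Prog S (D ++ Γ)) (P₂ : Prog S Γ) : Prog S Γ
  | nu {Γ : S.Cx} (t : S.T) (P : Prog S (Ty.sig t :: Γ)) : Prog S Γ
  | par {Γ : S.Cx} (P₁ P₂ : Prog S Γ) : Prog S Γ

/-- The programs whose only free variables are signal names. -/
abbrev Program (S : Signature) : Type := Prog S []

/-! ## Free names -/

/-- Free signal names of an expression. -/
def Term.fn {S : Signature} {Γ : S.Cx} : ∀ {t : S.T}, Term S Γ t → Set S.Name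
  | _, .var _ => ∅
  | _, .name (t := t) n => {(t, n)}
  | _, .con _ args => {a | ∃ u x, a ∈ (args u x).fn}

/-- Free signal names of an expression with dereferenciation. -/
def Rexp.fn {S : Signature} {Γ : S.Cx} : ∀ {t : S.T}, Rexp S Γ t → Set S.Name
  | _, .deref s => s.fn
  | _, .var _ => ∅
  | _, .name (t := t) n => {(t, n)}
  | _, .con _ args => {a | ∃ u x, a ∈ (args u x).fn}

/-- Free signal names of a program. -/
def Prog.fn {S : Signature} : ∀ {Γ : S.Cx}, Prog S Γ → Set S.Name
  | _, .zero => ∅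
  | _, .call _ e => {a | ∃ u x, a ∈ (e u x).fn}
  | _, .emit s e => s.fn ∪ e.fn
  | _, .present s P _ r => s.fn ∪ P.fn ∪ {a | ∃ u x, a ∈ (r u x).fn}
  | _, .ifEq s₁ s₂ P₁ P₂ => s₁.fn ∪ s₂.fn ∪ P₁.fn ∪ P₂.fn
  | _, .ifMatch u _ _ _ P₁ P₂ => u.fn ∪ P₁.fn ∪ P₂.fn
  | _, .nu _ P => P.fn
  | _, .par P₁ P₂ => P₁.fn ∪ P₂.fn

/-! ## Substitution -/

/-- Simultaneous substitutions for the variables of `Γ`. -/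
abbrev Sub (S : Signature) (Γ Δ : S.Cx) : Type := ∀ u : S.T, Var Γ u → Term S Δ u

/-- Simultaneous substitutions for the signal names. -/
abbrev NSub (S : Signature) (Δ : S.Cx) : Type := ∀ t : S.T, ℕ → Term S Δ (.sig t)

/-- The identity substitution of variables. -/
def Sub.id {S : Signature} {Γ : S.Cx} : Sub S Γ Γ := fun _ x => .var x

/-- The identity substitution of names. -/
def NSub.id {S : Signature} {Δ : S.Cx} : NSub S Δ := fun _ n => .name n

/-- The substitution `x₀ ↦ e`, and `ρ` on the other variables. -/
def Sub.cons {S : Signature} {Γ Δ : S.Cx} {t : S.T} (e : Term S Δ t) (ρ : Sub S Γ Δ) :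
    Sub S (t :: Γ) Δ
  | _, .zero => e
  | _, .succ x => ρ _ x

/-- Juxtaposition of two substitutions. -/
def Sub.append {S : Signature} {Γ Δ : S.Cx} :
    ∀ {D : S.Cx}, Sub S D Δ → Sub S Γ Δ → Sub S (D ++ Γ) Δ
  | [], _, ρ => ρ
  | _ :: _, σ, ρ => Sub.cons (σ _ .zero) (Sub.append (fun u x => σ u (.succ x)) ρ)

/-- Substitution in an expression. -/
def Term.sub {S : Signature} {Γ Δ : S.Cx} (ρ : Sub S Γ Δ) (θ : NSub S Δ) :
    ∀ {t : S.T}, Term S Γ t → Term S Δ t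
  | _, .var x => ρ _ x
  | _, .name n => θ _ n
  | _, .con c args => .con c (fun u x => (args u x).sub ρ θ)

/-- Weakening of an expression by one variable. -/
def Term.weaken {S : Signature} {Γ : S.Cx} {t w : S.T} (e : Term S Γ t) : Term S (w :: Γ) t :=
  e.sub (fun _ x => .var (.succ x)) NSub.id

/-- Passage of a substitution of variables under a binder. -/
def Sub.lift {S : Signature} {Γ Δ : S.Cx} {w : S.T} (ρ : Sub S Γ Δ) :
    Sub S (w :: Γ) (w :: Δ) :=
  Sub.cons (.var .zero) (fun u x => (ρ u x).weaken)

/-- Passage of a substitution of names under a binder. -/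
def NSub.lift {S : Signature} {Δ : S.Cx} {w : S.T} (θ : NSub S Δ) : NSub S (w :: Δ) :=
  fun t n => (θ t n).weaken

/-- Passage of a substitution of variables under several binders. -/
def Sub.lifts {S : Signature} {Γ Δ : S.Cx} (ρ : Sub S Γ Δ) : ∀ D : S.Cx, Sub S (D ++ Γ) (D ++ Δ)
  | [] => ρ
  | _ :: D => (Sub.lifts ρ D).lift

/-- Passage of a substitution of names under several binders. -/
def NSub.lifts {S : Signature} {Δ : S.Cx} (θ : NSub S Δ) : ∀ D : S.Cx, NSub S (D ++ Δ)
  | [] => θ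
  | _ :: D => (NSub.lifts θ D).lift

/-- Expressions are expressions with dereferenciation. -/
def Term.toRexp {S : Signature} {Γ : S.Cx} : ∀ {t : S.T}, Term S Γ t → Rexp S Γ t
  | _, .var x => .var x
  | _, .name n => .name n
  | _, .con c args => .con c (fun u x => (args u x).toRexp)

/-- Substitution in an expression with dereferenciation. -/
def Rexp.sub {S : Signature} {Γ Δ : S.Cx} (ρ : Sub S Γ Δ) (θ : NSub S Δ) :
    ∀ {t : S.T}, Rexp S Γ t → Rexp S Δ t
  | _, .deref s => .deref (s.sub ρ θ)
  | _, .var x => (ρ _ x).toRexp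
  | _, .name n => (θ _ n).toRexp
  | _, .con c args => .con c (fun u x => (args u x).sub ρ θ)

/-- Capture-avoiding substitution in a program. -/
def Prog.sub {S : Signature} : ∀ {Γ Δ : S.Cx}, Sub S Γ Δ → NSub S Δ → Prog S Γ → Prog S Δ
  | _, _, _, _, .zero => .zero
  | _, _, ρ, θ, .call A e => .call A (fun u x => (e u x).sub ρ θ)
  | _, _, ρ, θ, .emit s e => .emit (s.sub ρ θ) (e.sub ρ θ)
  | _, _, ρ, θ, .present s P A r =>
      .present (s.sub ρ θ) (P.sub ρ.lift θ.lift) A (fun u x => (r u x).sub ρ θ)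
  | _, _, ρ, θ, .ifEq s₁ s₂ P₁ P₂ =>
      .ifEq (s₁.sub ρ θ) (s₂.sub ρ θ) (P₁.sub ρ θ) (P₂.sub ρ θ)
  | _, _, ρ, θ, .ifMatch (D := D) u c p hp P₁ P₂ =>
      .ifMatch (u.sub ρ θ) c p hp (P₁.sub (ρ.lifts D) (θ.lifts D)) (P₂.sub ρ θ)
  | _, _, ρ, θ, .nu t P => .nu t (P.sub ρ.lift θ.lift)
  | _, _, ρ, θ, .par P₁ P₂ => .par (P₁.sub ρ θ) (P₂.sub ρ θ)

/-- `P.inst e` is `[e/x]P`, where `x` is the outermost variable of `P`. -/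
def Prog.inst {S : Signature} {t : S.T} (P : Prog S [t]) (e : Val S t) : Program S :=
  P.sub (Sub.cons e Sub.id) NSub.id

open Classical in
/-- The substitution that turns the name `a` into the new variable `0`. -/
noncomputable def NSub.close {S : Signature} {Γ : S.Cx} (a : S.Name) :
    NSub S (Ty.sig a.1 :: Γ) :=
  fun u m => if h : a = (u, m) then h ▸ .var .zero else .name m

/-- `res a P` is `ν a P`: the name `a`, which may be free in `P`, becomes bound. -/
noncomputable def Prog.res {S : Signature} (a : S.Name) (P : Program S) : Program S :=
  .nu a.1 (P.sub (fun _ x => .var (.succ x)) (NSub.close a))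

/-- `resList [a₁, …, aₙ] P` is `ν a₁, …, aₙ P`. -/
noncomputable def Prog.resList {S : Signature} (as : List S.Name) (P : Program S) : Program S :=
  as.foldr Prog.res P

/-- `σ(p)` for a substitution `σ` of values for the variables of the pattern `p`. -/
def Pat.inst {S : Signature} {D : S.Cx} (σ : Sub S D []) : ∀ {t : S.T}, Pat S D t → Val S t
  | _, .var x => σ _ x
  | _, .con c args => .con c (fun u x => (args u x).inst σ)

/-! ## Defining equations -/

/-- A system of equations `A(x) = P`, one for each thread identifier. The free variables of `P`,
signal names included, are among `x`. -/
structure Equations (S : Signature) where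
  body : ∀ A : S.Ident, Prog S (S.params A)
  closed : ∀ A : S.Ident, (body A).fn = ∅

/-! ## Transitions during an instant -/

/-- A signal name together with a value that it can carry. -/
structure Emission (S : Signature) where
  ty : S.T
  sig : ℕ
  val : Val S ty

/-- The name of the signal of an emission. -/
def Emission.name {S : Signature} (e : Emission S) : S.Name := (e.ty, e.sig)

/-- The program that emits `e`. -/
def Emission.prog {S : Signature} (e : Emission S) : Program S := .emit (.name e.sig) e.val

/-- Actions: internal, input `s v`, and output of `v` on `s` with extrusion of the names `ts`. -/
inductive Act (S : Signature) : Type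
  | tau : Act S
  | inp (e : Emission S) : Act S
  | out (ts : List S.Name) (e : Emission S) : Act S

/-- Bound names of an action. -/
def Act.bn {S : Signature} : Act S → Set S.Name
  | .tau => ∅
  | .inp _ => ∅
  | .out ts _ => {a | a ∈ ts}

/-- Names (free and bound) of an action. -/
def Act.names {S : Signature} : Act S → Set S.Name
  | .tau => ∅
  | .inp e => {e.name} ∪ e.val.fn
  | .out ts e => {e.name} ∪ e.val.fn ∪ {a | a ∈ ts}

/-- The labelled transition system. A restricted name is represented by any name `n` that is not
free in the scope of the restriction. -/
inductive Step {S : Signature} (D : Equations S) : Program S → Act S → Program S → Prop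
  | out {t : S.T} (s : ℕ) (v : Val S t) :
      Step D (.emit (.name s) v) (.out [] ⟨t, s, v⟩) (.emit (.name s) v)
  | inp {t : S.T} (s : ℕ) (v : Val S t) (P : Prog S [t]) (A : S.Ident)
      (r : ∀ u : S.T, Var (S.params A) u → Rexp S [] u) :
      Step D (.present (.name s) P A r) (.inp ⟨t, s, v⟩) (.par (P.inst v) (.emit (.name s) v))
  | parL {P₁ P₁' P₂ : Program S} {α : Act S} :
      Step D P₁ α P₁' → Disjoint α.bn P₂.fn → Step D (.par P₁ P₂) α (.par P₁' P₂)
  | parR {P₁ P₂ P₂' : Program S} {α : Act S} :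
      Step D P₂ α P₂' → Disjoint α.bn P₁.fn → Step D (.par P₁ P₂) α (.par P₁ P₂')
  | synchL {P₁ P₁' P₂ P₂' : Program S} {ts : List S.Name} {e : Emission S} :
      Step D P₁ (.out ts e) P₁' → Step D P₂ (.inp e) P₂' → Disjoint {a | a ∈ ts} P₂.fn →
      Step D (.par P₁ P₂) .tau (Prog.resList ts (.par P₁' P₂'))
  | synchR {P₁ P₁' P₂ P₂' : Program S} {ts : List S.Name} {e : Emission S} :
      Step D P₁ (.inp e) P₁' → Step D P₂ (.out ts e) P₂' → Disjoint {a | a ∈ ts} P₁.fn →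
      Step D (.par P₁ P₂) .tau (Prog.resList ts (.par P₁' P₂'))
  | nu {t : S.T} {P : Prog S [.sig t]} {P' : Program S} {α : Act S} (n : ℕ) :
      (t, n) ∉ P.fn → Step D (P.inst (.name n)) α P' → (t, n) ∉ α.names →
      Step D (.nu t P) α (Prog.res (t, n) P')
  | nuEx {t : S.T} {P : Prog S [.sig t]} {P' : Program S} {ts : List S.Name} {e : Emission S}
      (n : ℕ) :
      (t, n) ∉ P.fn → Step D (P.inst (.name n)) (.out ts e) P' →
      (t, n) ≠ e.name → (t, n) ∈ e.val.fn → (t, n) ∉ ts →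
      Step D (.nu t P) (.out ((t, n) :: ts) e) P'
  | eqSig {t : S.T} (s : ℕ) (P₁ P₂ : Program S) :
      Step D (.ifEq (t := t) (.name s) (.name s) P₁ P₂) .tau P₁
  | neSig {t : S.T} {s₁ s₂ : ℕ} (P₁ P₂ : Program S) :
      s₁ ≠ s₂ → Step D (.ifEq (t := t) (.name s₁) (.name s₂) P₁ P₂) .tau P₂
  | eqInd {t : S.T} {E ts : S.Cx} {v : Val S t} {c : Con S ts t}
      {p : ∀ w : S.T, Var ts w → Pat S E w}
      {hp : ∀ (w : S.T) (x : Var E w), Pat.Occurs x (Pat.con c p)}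
      {P₁ : Prog S (E ++ [])} {P₂ : Program S} (σ : Sub S E []) :
      Pat.inst σ (Pat.con c p) = v →
      Step D (.ifMatch v c p hp P₁ P₂) .tau (P₁.sub (Sub.append σ Sub.id) NSub.id)
  | neInd {t : S.T} {E ts : S.Cx} {v : Val S t} {c : Con S ts t}
      {p : ∀ w : S.T, Var ts w → Pat S E w}
      {hp : ∀ (w : S.T) (x : Var E w), Pat.Occurs x (Pat.con c p)}
      {P₁ : Prog S (E ++ [])} {P₂ : Program S} :
      (∀ σ : Sub S E [], Pat.inst σ (Pat.con c p) ≠ v) →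
      Step D (.ifMatch v c p hp P₁ P₂) .tau P₂
  | unfold (A : S.Ident) (v : ∀ u : S.T, Var (S.params A) u → Val S u) :
      Step D (.call A v) .tau ((D.body A).sub v NSub.id)

/-- Weak internal transitions. -/
def WTau {S : Signature} (D : Equations S) : Program S → Program S → Prop :=
  Relation.ReflTransGen (fun P P' => Step D P .tau P')

/-- Weak transitions `⇒ →α ⇒`, for `α` other than `tau`. -/
def WStep {S : Signature} (D : Equations S) (P : Program S) (α : Act S) (P' : Program S) : Prop :=
  ∃ P₁ P₂, WTau D P P₁ ∧ Step D P₁ α P₂ ∧ WTau D P₂ P'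

/-! ## Suspension predicates -/

/-- `P` is suspended. -/
def Susp {S : Signature} (D : Equations S) (P : Program S) : Prop := ¬ ∃ P', Step D P .tau P'

/-- Weak suspension. -/
def WSusp {S : Signature} (D : Equations S) (P : Program S) : Prop :=
  ∃ P', WTau D P P' ∧ Susp D P'

/-- L-suspension. -/
def LSusp {S : Signature} (D : Equations S) (P : Program S) : Prop :=
  ∃ P', Relation.ReflTransGen (fun Q Q' => ∃ α, Step D Q α Q') P P' ∧ Susp D P'

/-! ## The end of the instant -/

/-- Functions `V` from signal names to lists of values. -/
abbrev ListEnv (S : Signature) : Type := ∀ t : S.T, ℕ → List (Val S t)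

/-- A list of values as a value of list type. -/
def listVal {S : Signature} {t : S.T} : List (Val S t) → Val S (.list t)
  | [] => .con (.nil t) (fun _ x => nomatch x)
  | v :: l => .con (.cons t) (Sub.cons v (Sub.cons (listVal l) (fun _ x => nomatch x)))

/-- The name denoted by a closed expression of signal type. -/
def Term.sigId {S : Signature} {t : S.T} : Term S [] (.sig t) → ℕ
  | .name n => n

/-- `V(r)`: each `!s` is replaced by the list associated with `s`. -/
def Rexp.eval {S : Signature} (V : ListEnv S) : ∀ {t : S.T}, Rexp S [] t → Val S t
  | _, .deref (t := t) s => listVal (V t s.sigId)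
  | _, .name n => .name n
  | _, .con c args => .con c (fun u x => (args u x).eval V)

/-- The function `E` from signal names to sets of values is represented by its graph, the set of
pairs `(s, v)` with `v ∈ E(s)`. The list `V(a)` represents the set `E(a)`. -/
def Represents {S : Signature} (V : ListEnv S) (E : Set (Emission S)) (a : S.Name) : Prop :=
  (V a.1 a.2).Nodup ∧ ∀ v : Val S a.1, v ∈ V a.1 a.2 ↔ (⟨a.1, a.2, v⟩ : Emission S) ∈ E

/-- The auxiliary judgement at the end of the instant. The set `B` records the names chosen for the
restrictions that are crossed: as usual these names have to be pairwise distinct and different from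
the free names. -/
inductive EndStep {S : Signature} :
    Program S → Set (Emission S) → ListEnv S → Set S.Name → Program S → Prop
  | zero (V : ListEnv S) : EndStep .zero ∅ V ∅ .zero
  | out {t : S.T} (s : ℕ) (v : Val S t) (V : ListEnv S) :
      v ∈ V t s → EndStep (.emit (.name s) v) {⟨t, s, v⟩} V ∅ .zero
  | inp {t : S.T} (s : ℕ) (P : Prog S [t]) (A : S.Ident)
      (r : ∀ u : S.T, Var (S.params A) u → Rexp S [] u) (V : ListEnv S) :
      V t s = [] →
      EndStep (.present (.name s) P A r) ∅ V ∅ (.call A (fun u x => (r u x).eval V))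
  | par {P₁ P₁' P₂ P₂' : Program S} {E₁ E₂ : Set (Emission S)} {V : ListEnv S}
      {B₁ B₂ : Set S.Name} :
      EndStep P₁ E₁ V B₁ P₁' → EndStep P₂ E₂ V B₂ P₂' →
      Disjoint B₁ B₂ → Disjoint B₁ P₂.fn → Disjoint B₂ P₁.fn →
      EndStep (.par P₁ P₂) (E₁ ∪ E₂) V (B₁ ∪ B₂) (.par P₁' P₂')
  | nu {t : S.T} {P : Prog S [.sig t]} {P' : Program S} {E : Set (Emission S)} {V V' : ListEnv S}
      {B : Set S.Name} (n : ℕ) :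
      (t, n) ∉ P.fn → (t, n) ∉ B → EndStep (P.inst (.name n)) E V' B P' →
      Represents V' E (t, n) →
      (∀ (u : S.T) (m : ℕ), (u, m) ≠ (t, n) → V u m = V' u m) →
      EndStep (.nu t P) {e | e ∈ E ∧ e.name ≠ (t, n)} V (insert (t, n) B) (Prog.res (t, n) P')

/-- The transition `↦` at the end of the instant. -/
def Tick {S : Signature} (P P' : Program S) : Prop :=
  ∃ E V B, EndStep P E V B P' ∧ ∀ a : S.Name, Represents V E a

/-! ## Bisimulations -/

/-- Nonempty parallel compositions of emissions. -/
def emissions {S : Signature} : Emission S → List (Emission S) → Program S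
  | e, [] => e.prog
  | e, e' :: l => .par e.prog (emissions e' l)

/-- `P ∣ S` for the parallel composition `S` of `n ≥ 0` emissions; it is `P` if `n = 0`. -/
def withEmissions {S : Signature} (P : Program S) : List (Emission S) → Program S
  | [] => P
  | e :: l => .par P (emissions e l)

/-- `P` commits to emit on the signal `a`. -/
def Commits {S : Signature} (D : Equations S) (P : Program S) (a : S.Name) : Prop :=
  ∃ ts e P', e.name = a ∧ Step D P (.out ts e) P'

/-- Labelled bisimulations, where `susp` is the predicate in the premise of the output condition.
The order of the names extruded by an output is irrelevant. -/
structure IsLabelledBisim {S : Signature} (D : Equations S) (susp : Program S → Prop)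
    (R : Program S → Program S → Prop) : Prop where
  symm : ∀ P Q, R P Q → R Q P
  tau : ∀ P Q P', R P Q → Step D P .tau P' → ∃ Q', WTau D Q Q' ∧ R P' Q'
  out : ∀ P Q P' ts e, R P Q → Step D P (.out ts e) P' → susp P →
    Disjoint {a | a ∈ ts} Q.fn →
    ∃ ts' Q', ts'.Perm ts ∧ WStep D Q (.out ts' e) Q' ∧ R P' Q'
  inp : ∀ P Q P' e, R P Q → Step D P (.inp e) P' →
    ∃ Q', (WStep D Q (.inp e) Q' ∧ R P' Q') ∨ (WTau D Q Q' ∧ R P' (.par Q' e.prog))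
  tick : ∀ P Q l P'', R P Q → Susp D (withEmissions P l) → Tick (withEmissions P l) P'' →
    ∃ Q' Q'', WTau D (withEmissions Q l) Q' ∧ Susp D Q' ∧ R (withEmissions P l) Q' ∧
      Tick Q' Q'' ∧ R P'' Q''

/-- Barbed bisimulations, where `susp` is the predicate in the premise of the commitment
condition. -/
structure IsBarbedBisim {S : Signature} (D : Equations S) (susp : Program S → Prop)
    (R : Program S → Program S → Prop) : Prop where
  symm : ∀ P Q, R P Q → R Q P
  tau : ∀ P Q P', R P Q → Step D P .tau P' → ∃ Q', WTau D Q Q' ∧ R P' Q'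
  commit : ∀ P Q a, R P Q → Commits D P a → susp P →
    ∃ Q', WTau D Q Q' ∧ Commits D Q' a ∧ R P Q'
  tick : ∀ P Q P'', R P Q → Susp D P → Tick P P'' →
    ∃ Q' Q'', WTau D Q Q' ∧ Susp D Q' ∧ R P Q' ∧ Tick Q' Q'' ∧ R P'' Q''

/-- Static contexts. -/
inductive StaticCtx (S : Signature) : Type
  | hole : StaticCtx S
  | par (C : StaticCtx S) (P : Program S) : StaticCtx S
  | nu (a : S.Name) (C : StaticCtx S) : StaticCtx S

/-- `C[P]`; a restriction of the context binds the free occurrences of its name in `P`. -/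
noncomputable def StaticCtx.fill {S : Signature} : StaticCtx S → Program S → Program S
  | .hole, P => P
  | .par C Q, P => .par (C.fill P) Q
  | .nu a C, P => Prog.res a (C.fill P)

/-- Contextual bisimulations. -/
structure IsContextualBisim {S : Signature} (D : Equations S) (susp : Program S → Prop)
    (R : Program S → Program S → Prop) : Prop where
  barbed : IsBarbedBisim D susp R
  ctx : ∀ P Q (C : StaticCtx S), R P Q → R (C.fill P) (C.fill Q)

/-- The largest labelled bisimulation. -/
def LabelledBisim {S : Signature} (D : Equations S) (susp : Program S → Prop)
    (P Q : Program S) : Prop := ∃ R, IsLabelledBisim D susp R ∧ R P Q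

/-- The largest barbed bisimulation. -/
def BarbedBisim {S : Signature} (D : Equations S) (susp : Program S → Prop)
    (P Q : Program S) : Prop := ∃ R, IsBarbedBisim D susp R ∧ R P Q

/-- The largest contextual bisimulation. -/
def ContextualBisim {S : Signature} (D : Equations S) (susp : Program S → Prop)
    (P Q : Program S) : Prop := ∃ R, IsContextualBisim D susp R ∧ R P Q

/-- A relation on programs is preserved by parallel composition. -/
def PreservedByPar {S : Signature} (R : Program S → Program S → Prop) : Prop :=
  ∀ P Q T : Program S, R P Q → R (.par P T) (.par Q T)

end SPi

/-!
The inclusions hold because suspension implies weak suspension, which implies L-suspension: a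
stronger predicate in the premise of the output (or commitment) condition makes this condition
weaker, so that a bisimulation for `LSusp` is one for `WSusp`, and a bisimulation for `WSusp` is one
for `Susp`.

All counterexamples are built from one thread, `race hL B`, which reads a value on a signal `t`,
loops if this is value `0`, and otherwise becomes the parallel composition of emissions `B`. The
program `early hL` emits on another signal `s` from the beginning, in parallel with `race hL 0`. In
`late hL` the emissions on `s` are the result `B` of the race. Both programs emit value `0` on `t`.
* Internally, `early hL` and `late hL` can only diverge. Hence no output is observed for `WSusp`,
  and the programs are equivalent: if they receive a value other than `0` on `t`, both suspend with
  the same emissions. Because of such inputs they are L-suspended, so that for `LSusp` the early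
  emissions on `s` are observed: `IsTest.false_of_lsusp`.
* With an emission of value `1` on `t` in parallel, both programs can diverge and can suspend with
  the same emissions. For `Susp` outputs are only observed after the race, and the programs are
  equivalent. They are distinguished for `WSusp`, because `late` has to decide the race before it
  emits on `s`: `IsTest.false_of_wsusp`. In particular the equivalence of `early` and `late` for
  `WSusp` is not preserved by parallel composition.
* A thread that reads a value on `s` and emits on this value distinguishes the two programs of the
  second item also for `Susp`, since with `early` a value can be chosen while the race is undecided:
  `IsTest.false_of_relay`.
* Barbed bisimulations ignore inputs, so they identify `race hL 0` and `race hL B`, which an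
  emission of value `1` on `t` distinguishes: `IsTest.false_of_result`.

The equivalences in the first two items are instances of one relation, `RaceRel`, which is both a
labelled and a barbed bisimulation. It relates programs according to the state of the race, which
is pending, lost (`Diverging`) or won (`Settling`). The inequivalences are proved from the
properties `IsTest` that labelled and barbed bisimulations have in common.
-/

namespace SPi

variable {S : Signature} {D : Equations S}

/-! ### Emissions in parallel -/

/-- `Inert P E`: the program `P` is a parallel composition of emissions and of copies of `0`, and
`E` is the set of its emissions. -/
inductive Inert : Program S → Set (Emission S) → Prop
  | zero : Inert .zero ∅
  | emit {t : S.T} (s : ℕ) (v : Val S t) : Inert (.emit (.name s) v) {⟨t, s, v⟩}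
  | par {P Q : Program S} {E F : Set (Emission S)} :
      Inert P E → Inert Q F → Inert (.par P Q) (E ∪ F)

/-- `Hosts ℓ P E`: the program `P` is the parallel composition, in some order, of the thread `ℓ`
and an inert program with emissions `E`. -/
inductive Hosts (ℓ : Program S) : Program S → Set (Emission S) → Prop
  | here : Hosts ℓ ℓ ∅
  | parL {P Q : Program S} {E F : Set (Emission S)} :
      Hosts ℓ P E → Inert Q F → Hosts ℓ (.par P Q) (E ∪ F)
  | parR {P Q : Program S} {E F : Set (Emission S)} :
      Inert P E → Hosts ℓ Q F → Hosts ℓ (.par P Q) (E ∪ F)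

theorem disjoint_mem_nil {α : Type*} (s : Set α) : Disjoint {a : α | a ∈ ([] : List α)} s := by
  simp

theorem Inert.step {P P' : Program S} {E : Set (Emission S)} {α : Act S} (h : Inert P E)
    (hs : Step D P α P') : ∃ e ∈ E, α = .out [] e ∧ P' = P := by
  induction h generalizing α P' with
  | zero => cases hs
  | emit s v => cases hs; exact ⟨_, rfl, rfl, rfl⟩
  | par _ _ ih₁ ih₂ =>
    cases hs with
    | parL h _ => obtain ⟨e, he, rfl, rfl⟩ := ih₁ h; exact ⟨e, .inl he, rfl, rfl⟩
    | parR h _ => obtain ⟨e, he, rfl, rfl⟩ := ih₂ h; exact ⟨e, .inr he, rfl, rfl⟩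
    | synchL _ h _ => obtain ⟨e, -, h, -⟩ := ih₂ h; cases h
    | synchR h _ _ => obtain ⟨e, -, h, -⟩ := ih₁ h; cases h

theorem Inert.out {P : Program S} {E : Set (Emission S)} (h : Inert P E) {e : Emission S}
    (he : e ∈ E) : Step D P (.out [] e) P := by
  induction h with
  | zero => cases he
  | emit s v => cases he; exact .out s v
  | par _ _ ih₁ ih₂ =>
    rcases he with he | he
    · exact .parL (ih₁ he) (disjoint_mem_nil _)
    · exact .parR (ih₂ he) (disjoint_mem_nil _)

theorem Inert.susp {P : Program S} {E : Set (Emission S)} (h : Inert P E) : Susp D P := by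
  rintro ⟨P', hs⟩
  obtain ⟨e, -, h, -⟩ := h.step hs
  cases h

theorem Inert.finite {P : Program S} {E : Set (Emission S)} (h : Inert P E) : E.Finite := by
  induction h with
  | zero => exact Set.finite_empty
  | emit s v => exact Set.finite_singleton _
  | par _ _ ih₁ ih₂ => exact ih₁.union ih₂

theorem Inert.wtau {P P' : Program S} {E : Set (Emission S)} (h : Inert P E)
    (hs : WTau D P P') : P' = P := by
  induction hs with
  | refl => rfl
  | tail _ hs ih => subst ih; exact (h.susp ⟨_, hs⟩).elim

theorem Inert.endStep {P P' : Program S} {E F : Set (Emission S)} {V : ListEnv S}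
    {B : Set S.Name} (h : Inert P E) (hs : EndStep P F V B P') : Inert P' ∅ := by
  induction h generalizing F B P' with
  | zero => cases hs; exact .zero
  | emit s v => cases hs; exact .zero
  | par _ _ ih₁ ih₂ =>
    cases hs with
    | par h₁ h₂ => simpa using (ih₁ h₁).par (ih₂ h₂)

theorem Inert.exists_endStep {P : Program S} {E : Set (Emission S)} {V : ListEnv S}
    (h : Inert P E) (hV : ∀ e ∈ E, e.val ∈ V e.ty e.sig) : ∃ P', EndStep P E V ∅ P' := by
  induction h with
  | zero => exact ⟨_, .zero V⟩
  | emit s v => exact ⟨_, .out s v V (hV _ rfl)⟩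
  | par _ _ ih₁ ih₂ =>
    obtain ⟨P₁, h₁⟩ := ih₁ fun e he => hV e (.inl he)
    obtain ⟨P₂, h₂⟩ := ih₂ fun e he => hV e (.inr he)
    refine ⟨.par P₁ P₂, ?_⟩
    simpa using EndStep.par h₁ h₂ (by simp) (by simp) (by simp)

theorem exists_represents {E : Set (Emission S)} (hE : E.Finite) :
    ∃ V : ListEnv S, ∀ a, Represents V E a := by
  have hfin : ∀ (t : S.T) (n : ℕ), {v : Val S t | (⟨t, n, v⟩ : Emission S) ∈ E}.Finite :=
    fun t n => hE.preimage fun v _ w _ h => by cases h; rfl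
  exact ⟨fun t n => (hfin t n).toFinset.toList,
    fun a => ⟨Finset.nodup_toList _, fun v => by simp⟩⟩

theorem Inert.exists_tick {P : Program S} {E : Set (Emission S)} (h : Inert P E) :
    ∃ P', Tick P P' := by
  obtain ⟨V, hV⟩ := exists_represents h.finite
  obtain ⟨P', hP'⟩ := h.exists_endStep fun e he => ((hV e.name).2 e.val).2 he
  exact ⟨P', E, V, ∅, hP', hV⟩

theorem Inert.tick {P P' : Program S} {E : Set (Emission S)} (h : Inert P E)
    (ht : Tick P P') : Inert P' ∅ := by
  obtain ⟨F, V, B, hs, -⟩ := ht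
  exact h.endStep hs

theorem inert_emissions (e : Emission S) (l : List (Emission S)) :
    Inert (emissions e l) {x | x ∈ e :: l} := by
  induction l generalizing e with
  | nil => simpa [emissions, Emission.prog] using Inert.emit e.sig e.val
  | cons e' l ih =>
    have h := (Inert.emit e.sig e.val).par (ih e')
    have hE : ({⟨e.ty, e.sig, e.val⟩} ∪ {x | x ∈ e' :: l} : Set (Emission S)) =
        {x | x ∈ e :: e' :: l} := by
      ext x; simp
    rwa [hE] at h

theorem Inert.withEmissions {P : Program S} {E : Set (Emission S)} (h : Inert P E)
    (l : List (Emission S)) : Inert (withEmissions P l) (E ∪ {x | x ∈ l}) := by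
  cases l with
  | nil => simpa [SPi.withEmissions] using h
  | cons e l => exact h.par (inert_emissions e l)

/-! ### Weak transitions and parallel composition -/

theorem WTau.par {P P' : Program S} (h : WTau D P P') (Q : Program S) :
    WTau D (.par P Q) (.par P' Q) := by
  induction h with
  | refl => exact .refl
  | tail _ hs ih => exact ih.tail (.parL hs (Set.empty_disjoint _))

theorem WTau.withEmissions {P P' : Program S} (h : WTau D P P') (l : List (Emission S)) :
    WTau D (withEmissions P l) (withEmissions P' l) := by
  cases l with
  | nil => exact h
  | cons e l => exact h.par _

theorem Susp.of_withEmissions {P : Program S} {l : List (Emission S)}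
    (h : Susp D (withEmissions P l)) : Susp D P := by
  rintro ⟨P', hs⟩
  cases l with
  | nil => exact h ⟨_, hs⟩
  | cons e l => exact h ⟨_, .parL hs (Set.empty_disjoint _)⟩

theorem Susp.wsusp {P : Program S} (h : Susp D P) : WSusp D P := ⟨P, .refl, h⟩

theorem WSusp.lsusp {P : Program S} (h : WSusp D P) : LSusp D P := by
  obtain ⟨P', hw, hs⟩ := h
  exact ⟨P', Relation.ReflTransGen.mono (fun _ _ h => ⟨_, h⟩) _ _ hw, hs⟩

/-- A property that is stable under internal steps and excludes suspension excludes weak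
suspension. -/
theorem not_wsusp_of_invariant {I : Program S → Prop}
    (hstep : ∀ P P', I P → Step D P .tau P' → I P') (hne : ∀ P, I P → ¬ Susp D P)
    {P : Program S} (h : I P) : ¬ WSusp D P := by
  rintro ⟨P', hw, hs⟩
  refine hne P' ?_ hs
  clear hs
  induction hw with
  | refl => exact h
  | tail _ hs ih => exact hstep _ _ ih hs

/-! ### A thread among emissions -/

theorem Hosts.trans {ℓ m P : Program S} {E F : Set (Emission S)} (h : Hosts ℓ P E)
    (h' : Hosts m ℓ F) : Hosts m P (E ∪ F) := by
  induction h with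
  | here => simpa using h'
  | parL _ hQ ih => rw [Set.union_right_comm]; exact ih.parL hQ
  | parR hP _ ih => rw [Set.union_assoc]; exact .parR hP ih

theorem Hosts.inert {ℓ P : Program S} {E F : Set (Emission S)} (h : Hosts ℓ P E)
    (h' : Inert ℓ F) : Inert P (E ∪ F) := by
  induction h with
  | here => simpa using h'
  | parL _ hQ ih => rw [Set.union_right_comm]; exact ih.par hQ
  | parR hP _ ih => rw [Set.union_assoc]; exact .par hP ih

theorem Hosts.out {ℓ P : Program S} {E : Set (Emission S)} (h : Hosts ℓ P E) {e : Emission S}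
    (he : e ∈ E) : Step D P (.out [] e) P := by
  induction h with
  | here => cases he
  | parL _ hQ ih =>
    rcases he with he | he
    · exact .parL (ih he) (disjoint_mem_nil _)
    · exact .parR (hQ.out he) (disjoint_mem_nil _)
  | parR hP _ ih =>
    rcases he with he | he
    · exact .parL (hP.out he) (disjoint_mem_nil _)
    · exact .parR (ih he) (disjoint_mem_nil _)

theorem Hosts.lift_step {ℓ ℓ' P : Program S} {E : Set (Emission S)} (h : Hosts ℓ P E) {α : Act S}
    (hα : α.bn = ∅) (hs : Step D ℓ α ℓ') : ∃ P', Step D P α P' ∧ Hosts ℓ' P' E := by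
  induction h with
  | here => exact ⟨ℓ', hs, .here⟩
  | parL _ hQ ih =>
    obtain ⟨P', h₁, h₂⟩ := ih
    exact ⟨_, .parL h₁ (hα ▸ Set.empty_disjoint _), h₂.parL hQ⟩
  | parR hP _ ih =>
    obtain ⟨P', h₁, h₂⟩ := ih
    exact ⟨_, .parR h₁ (hα ▸ Set.empty_disjoint _), .parR hP h₂⟩

theorem Hosts.synch {ℓ ℓ' P : Program S} {E : Set (Emission S)} (h : Hosts ℓ P E)
    {e : Emission S} (he : e ∈ E) (hs : Step D ℓ (.inp e) ℓ') :
    ∃ P', Step D P .tau P' ∧ Hosts ℓ' P' E := by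
  induction h with
  | here => cases he
  | parL hP hQ ih =>
    rcases he with he | he
    · obtain ⟨P', h₁, h₂⟩ := ih he
      exact ⟨_, .parL h₁ (Set.empty_disjoint _), h₂.parL hQ⟩
    · obtain ⟨P', h₁, h₂⟩ := hP.lift_step rfl hs
      exact ⟨_, .synchR h₁ (hQ.out he) (disjoint_mem_nil _), h₂.parL hQ⟩
  | parR hP hQ ih =>
    rcases he with he | he
    · obtain ⟨P', h₁, h₂⟩ := hQ.lift_step rfl hs
      exact ⟨_, .synchL (hP.out he) h₁ (disjoint_mem_nil _), .parR hP h₂⟩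
    · obtain ⟨P', h₁, h₂⟩ := ih he
      exact ⟨_, .parR h₁ (Set.empty_disjoint _), .parR hP h₂⟩

/-- The transitions of `P` are the outputs of the inert part, the transitions of `ℓ`, and the
synchronisations in which `ℓ` receives an emission of the inert part. -/
theorem Hosts.step {ℓ P P' : Program S} {E : Set (Emission S)} {α : Act S} (h : Hosts ℓ P E)
    (hs : Step D P α P') :
    (∃ e ∈ E, α = .out [] e ∧ P' = P) ∨
      ∃ ℓ', Hosts ℓ' P' E ∧ (Step D ℓ α ℓ' ∨ α = .tau ∧ ∃ e ∈ E, Step D ℓ (.inp e) ℓ') := by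
  induction h generalizing α P' with
  | here => exact .inr ⟨P', .here, .inl hs⟩
  | parL _ hQ ih =>
    cases hs with
    | parL h _ =>
      rcases ih h with ⟨e, he, rfl, rfl⟩ | ⟨ℓ', h₁, h₂⟩
      · exact .inl ⟨e, .inl he, rfl, rfl⟩
      · exact .inr ⟨ℓ', h₁.parL hQ, h₂.imp_right fun ⟨h, e, he, h'⟩ => ⟨h, e, .inl he, h'⟩⟩
    | parR h _ => obtain ⟨e, he, rfl, rfl⟩ := hQ.step h; exact .inl ⟨e, .inr he, rfl, rfl⟩
    | synchL _ h _ => obtain ⟨e, -, h, -⟩ := hQ.step h; cases h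
    | synchR h h' _ =>
      obtain ⟨e, he, heq, rfl⟩ := hQ.step h'
      cases heq
      rcases ih h with ⟨e', he', h'', -⟩ | ⟨ℓ', h₁, h₂ | ⟨h₂, -⟩⟩
      · cases h''
      · exact .inr ⟨ℓ', h₁.parL hQ, .inr ⟨rfl, _, .inr he, h₂⟩⟩
      · cases h₂
  | parR hP _ ih =>
    cases hs with
    | parR h _ =>
      rcases ih h with ⟨e, he, rfl, rfl⟩ | ⟨ℓ', h₁, h₂⟩
      · exact .inl ⟨e, .inr he, rfl, rfl⟩
      · exact .inr ⟨ℓ', .parR hP h₁, h₂.imp_right fun ⟨h, e, he, h'⟩ => ⟨h, e, .inr he, h'⟩⟩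
    | parL h _ => obtain ⟨e, he, rfl, rfl⟩ := hP.step h; exact .inl ⟨e, .inl he, rfl, rfl⟩
    | synchR h _ _ => obtain ⟨e, -, h, -⟩ := hP.step h; cases h
    | synchL h h' _ =>
      obtain ⟨e, he, heq, rfl⟩ := hP.step h
      cases heq
      rcases ih h' with ⟨e', he', h'', -⟩ | ⟨ℓ', h₁, h₂ | ⟨h₂, -⟩⟩
      · cases h''
      · exact .inr ⟨ℓ', .parR hP h₁, .inr ⟨rfl, _, .inl he, h₂⟩⟩
      · cases h₂

/-! ### The racing thread -/

/-- The only vector of expressions for an identifier without parameters. -/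
def noArgs {β : S.T → Type} {A : S.Ident} (h : S.params A = []) :
    ∀ u : S.T, Var (S.params A) u → β u :=
  fun _ x => nomatch (h ▸ x : Var [] _)

/-- The type `sig 1` of the names that can be emitted on names of type `sig (sig 1)`. -/
abbrev Signature.T₁ (S : Signature) : S.T := .sig .one

/-- The type `sig (sig 1)` of the values of the two signals `trigger` and `signal`. -/
abbrev Signature.T₂ (S : Signature) : S.T := .sig S.T₁

/-- The emission of the `n`-th value on the signal that the racing thread reads. -/
def trigger (n : ℕ) : Emission S := ⟨S.T₂, 0, .name n⟩

/-- The emission of the `n`-th value on the observed signal. -/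
def signal (n : ℕ) : Emission S := ⟨S.T₂, 1, .name n⟩

/-- The name of the observed signal. -/
def sigName : S.Name := (S.T₂, 1)

/-- The emission of a fixed value on the `n`-th value of `trigger` and `signal`, which is itself a
signal name. -/
def echo (n : ℕ) : Emission S := ⟨S.T₁, n, .name 0⟩

/-- The test `[n = 0] L(), R` of the `n`-th value, where `L` is the looping identifier. -/
def test (n : ℕ) (L : S.Ident) (e : ∀ u : S.T, Var (S.params L) u → Term S [] u)
    (R : Program S) : Program S :=
  .ifEq (t := S.T₁) (.name n) (.name 0) (.call L e) R

/-- The thread that reads a value on the signal of `trigger`, loops if this is value `0`, and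
becomes `B` otherwise. The outcome is a race between the emissions on that signal. -/
def race {L : S.Ident} (hL : S.params L = []) (B : Prog S [S.T₂]) : Program S :=
  .present (.name 0) (.ifEq (t := S.T₁) (.var .zero) (.name 0) (.call L (noArgs hL)) B)
    L (noArgs hL)

theorem Val.eq_name {t : S.T} (u : Val S (.sig t)) : ∃ n, u = .name n := by
  cases u with
  | var x => nomatch x
  | name n => exact ⟨n, rfl⟩
  | con c args => nomatch c

section Race

variable {L : S.Ident} {hL : S.params L = []}

theorem race_step {B : Prog S [S.T₂]} {α : Act S} {P : Program S}
    (h : Step D (race hL B) α P) :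
    ∃ n e, α = .inp (trigger n) ∧
      P = .par (test n L e (B.inst (.name n))) (.emit (.name 0) (.name n : Term S [] S.T₂)) := by
  cases h with
  | inp s v =>
    obtain ⟨n, rfl⟩ := Val.eq_name v
    exact ⟨n, _, rfl, rfl⟩

theorem race_inp (B : Prog S [S.T₂]) (n : ℕ) :
    ∃ e, Step D (race hL B) (.inp (trigger n))
      (.par (test n L e (B.inst (.name n))) (.emit (.name 0) (.name n : Term S [] S.T₂))) :=
  ⟨_, .inp _ _ _ _ _⟩

theorem test_step {n : ℕ} {e : ∀ u : S.T, Var (S.params L) u → Term S [] u}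
    {R P : Program S} {α : Act S} (h : Step D (test n L e R) α P) :
    α = .tau ∧ (n = 0 ∧ P = .call L e ∨ n ≠ 0 ∧ P = R) := by
  cases h with
  | eqSig => exact ⟨rfl, .inl ⟨rfl, rfl⟩⟩
  | neSig _ _ hne => exact ⟨rfl, .inr ⟨hne, rfl⟩⟩

theorem loop_step (hbody : D.body L = .call L fun _ x => .var x)
    {e : ∀ u : S.T, Var (S.params L) u → Term S [] u} {α : Act S} {P : Program S}
    (h : Step D (.call L e) α P) : α = .tau ∧ P = .call L e := by
  cases h with
  | unfold => exact ⟨rfl, by rw [hbody]; rfl⟩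

/-! ### Diverging, settling and waiting programs -/

/-- The program has the emissions `E` and a looping thread. -/
def Diverging (L : S.Ident) (E : Set (Emission S)) (P : Program S) : Prop :=
  ∃ ℓ, Hosts ℓ P E ∧ ∃ e, (∃ R, ℓ = test 0 L e R) ∨ ℓ = .call L e

/-- The program does nothing but perform the emissions in `G`, possibly after one internal step. -/
def Settling (L : S.Ident) (G : Set (Emission S)) (P : Program S) : Prop :=
  Inert P G ∨ ∃ n e R E F, n ≠ 0 ∧ Hosts (test n L e R) P E ∧ Inert R F ∧ G = E ∪ F

/-- The result of the race when value `n` is received, where `E` and `G` are the emissions before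
and after the race. -/
def Outcome (L : S.Ident) (n : ℕ) (E G : Set (Emission S)) (P : Program S) : Prop :=
  n = 0 ∧ Diverging L (E ∪ {trigger n}) P ∨ n ≠ 0 ∧ Settling L (E ∪ {trigger n} ∪ G) P

theorem Diverging.step (hbody : D.body L = .call L fun _ x => .var x) {E : Set (Emission S)}
    {P P' : Program S} {α : Act S} (h : Diverging L E P) (hs : Step D P α P') :
    (∃ e ∈ E, α = .out [] e ∧ P' = P) ∨ α = .tau ∧ Diverging L E P' := by
  obtain ⟨ℓ, hℓ, e, hor⟩ := h
  have key : ∀ α ℓ', Step D ℓ α ℓ' → α = .tau ∧ ℓ' = .call L e := by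
    intro α ℓ' h
    rcases hor with ⟨R, rfl⟩ | rfl
    · obtain ⟨h₁, ⟨-, h₂⟩ | ⟨h₂, -⟩⟩ := test_step h
      · exact ⟨h₁, h₂⟩
      · exact absurd rfl h₂
    · exact loop_step hbody h
  rcases hℓ.step hs with h | ⟨ℓ', h₁, h₂ | ⟨-, _, _, h₂⟩⟩
  · exact .inl h
  · obtain ⟨rfl, rfl⟩ := key _ _ h₂
    exact .inr ⟨rfl, _, h₁, e, .inr rfl⟩
  · cases (key _ _ h₂).1

theorem Diverging.not_susp {E : Set (Emission S)} {P : Program S} (h : Diverging L E P) :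
    ¬ Susp D P := by
  obtain ⟨ℓ, hℓ, e, ⟨R, rfl⟩ | rfl⟩ := h
  · obtain ⟨P', hs, -⟩ := hℓ.lift_step (α := .tau) rfl (.eqSig 0 _ R)
    exact fun h => h ⟨P', hs⟩
  · obtain ⟨P', hs, -⟩ := hℓ.lift_step (α := .tau) rfl (.unfold L e)
    exact fun h => h ⟨P', hs⟩

theorem Diverging.not_wsusp (hbody : D.body L = .call L fun _ x => .var x)
    {E : Set (Emission S)} {P : Program S} (h : Diverging L E P) : ¬ WSusp D P :=
  not_wsusp_of_invariant (I := Diverging L E)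
    (fun P P' h hs => by
      rcases h.step hbody hs with ⟨e, -, h, -⟩ | h
      · cases h
      · exact h.2)
    (fun _ h => h.not_susp) h

theorem Settling.step {G : Set (Emission S)} {P P' : Program S} {α : Act S}
    (h : Settling L G P) (hs : Step D P α P') :
    (∃ e ∈ G, α = .out [] e ∧ P' = P) ∨ α = .tau ∧ Inert P' G := by
  rcases h with h | ⟨n, e, R, E, F, hn, hP, hR, rfl⟩
  · exact .inl (h.step hs)
  · rcases hP.step hs with
      ⟨e, he, h⟩ | ⟨ℓ', h₁, h₂ | ⟨-, _, _, h₂⟩⟩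
    · exact .inl ⟨e, .inl he, h⟩
    · obtain ⟨rfl, ⟨h, -⟩ | ⟨-, rfl⟩⟩ := test_step h₂
      · exact absurd h hn
      · exact .inr ⟨rfl, h₁.inert hR⟩
    · cases (test_step h₂).1

theorem Settling.exists_inert {G : Set (Emission S)} {P : Program S} (h : Settling L G P) :
    ∃ P', WTau D P P' ∧ Inert P' G := by
  rcases h with h | ⟨n, e, R, E, F, hn, hP, hR, rfl⟩
  · exact ⟨P, .refl, h⟩
  · obtain ⟨P', hs, h'⟩ := hP.lift_step (D := D) (α := .tau) rfl (.neSig _ R hn)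
    exact ⟨P', .single hs, h'.inert hR⟩

theorem Settling.inert_of_susp {G : Set (Emission S)} {P : Program S} (h : Settling L G P)
    (hs : Susp D P) : Inert P G := by
  rcases h with h | ⟨n, e, R, E, F, hn, hP, hR, rfl⟩
  · exact h
  · obtain ⟨P', h', -⟩ := hP.lift_step (D := D) (α := .tau) rfl (.neSig _ R hn)
    exact (hs ⟨P', h'⟩).elim

variable {B : Prog S [S.T₂]} {G : Set (Emission S)}

theorem Hosts.outcome (hB : ∀ u, Inert (B.inst u) G) {P : Program S} {E : Set (Emission S)} {n : ℕ}
    {e : ∀ u : S.T, Var (S.params L) u → Term S [] u}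
    (h : Hosts (.par (test n L e (B.inst (.name n)))
      (.emit (.name 0) (.name n : Term S [] S.T₂))) P E) : Outcome L n E G P := by
  have h' := Hosts.here.parL (.emit 0 (.name n : Term S [] S.T₂))
    (ℓ := test n L e (B.inst (.name n)))
  have hP := h.trans h'
  rw [Set.empty_union] at hP
  by_cases hn : n = 0
  · subst hn
    exact .inl ⟨rfl, _, hP, e, .inl ⟨_, rfl⟩⟩
  · exact .inr ⟨hn, .inr ⟨n, e, _, _, G, hn, hP, hB _, rfl⟩⟩

theorem Hosts.race_step (hB : ∀ u, Inert (B.inst u) G) {P P' : Program S} {E : Set (Emission S)}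
    {α : Act S} (h : Hosts (race hL B) P E) (hs : Step D P α P') :
    (∃ e ∈ E, α = .out [] e ∧ P' = P) ∨
      ∃ n, (α = .inp (trigger n) ∨ α = .tau ∧ trigger n ∈ E) ∧ Outcome L n E G P' := by
  rcases h.step hs with h | ⟨ℓ', h₁, h₂ | ⟨rfl, e, he, h₂⟩⟩
  · exact .inl h
  · obtain ⟨n, e, rfl, rfl⟩ := SPi.race_step h₂
    exact .inr ⟨n, .inl rfl, h₁.outcome hB⟩
  · obtain ⟨n, e', h, rfl⟩ := SPi.race_step h₂
    cases h
    exact .inr ⟨n, .inr ⟨rfl, he⟩, h₁.outcome hB⟩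

theorem Hosts.race_inp (hB : ∀ u, Inert (B.inst u) G) {P : Program S} {E : Set (Emission S)}
    (h : Hosts (race hL B) P E) (n : ℕ) :
    ∃ P', Step D P (.inp (trigger n)) P' ∧ Outcome L n E G P' := by
  obtain ⟨e, he⟩ := SPi.race_inp (D := D) (hL := hL) B n
  obtain ⟨P', h₁, h₂⟩ := h.lift_step rfl he
  exact ⟨P', h₁, h₂.outcome hB⟩

theorem Hosts.race_synch (hB : ∀ u, Inert (B.inst u) G) {P : Program S} {E : Set (Emission S)}
    (h : Hosts (race hL B) P E) {n : ℕ} (hn : trigger n ∈ E) :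
    ∃ P', Step D P .tau P' ∧ Outcome L n E G P' := by
  obtain ⟨e, he⟩ := SPi.race_inp (D := D) (hL := hL) B n
  obtain ⟨P', h₁, h₂⟩ := h.synch hn he
  exact ⟨P', h₁, h₂.outcome hB⟩

theorem Outcome.tau (hbody : D.body L = .call L fun _ x => .var x) {n : ℕ}
    {E : Set (Emission S)} {P P' : Program S} (h : Outcome L n E G P) (hs : Step D P .tau P') :
    Outcome L n E G P' := by
  rcases h with ⟨hn, h⟩ | ⟨hn, h⟩
  · rcases h.step hbody hs with ⟨e, -, h, -⟩ | h
    · cases h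
    · exact .inl ⟨hn, h.2⟩
  · rcases h.step hs with ⟨e, -, h, -⟩ | h
    · cases h
    · exact .inr ⟨hn, .inl h.2⟩

theorem Hosts.race_wtau (hbody : D.body L = .call L fun _ x => .var x)
    (hB : ∀ u, Inert (B.inst u) G) {P P' : Program S} {E : Set (Emission S)}
    (h : Hosts (race hL B) P E) (hs : WTau D P P') :
    Hosts (race hL B) P' E ∨ ∃ n, trigger n ∈ E ∧ Outcome L n E G P' := by
  induction hs with
  | refl => exact .inl h
  | tail _ hs ih =>
    rcases ih with ih | ⟨n, hn, ih⟩
    · rcases ih.race_step hB hs with ⟨e, -, h, -⟩ | ⟨n, h | ⟨-, hn⟩, h'⟩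
      · cases h
      · cases h
      · exact .inr ⟨n, hn, h'⟩
    · exact .inr ⟨n, hn, ih.tau hbody hs⟩

theorem Hosts.race_not_susp {P : Program S} {E : Set (Emission S)} (h : Hosts (race hL B) P E)
    {n : ℕ} (hn : trigger n ∈ E) : ¬ Susp D P := by
  obtain ⟨e, he⟩ := SPi.race_inp (D := D) (hL := hL) B n
  obtain ⟨P', h', -⟩ := h.synch hn he
  exact fun hs => hs ⟨P', h'⟩

/-- If every emission on the signal of `trigger` carries value `0`, the race ends in a loop. -/
theorem Hosts.race_not_wsusp (hbody : D.body L = .call L fun _ x => .var x)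
    (hB : ∀ u, Inert (B.inst u) G) {P : Program S} {E : Set (Emission S)}
    (h : Hosts (race hL B) P E) (hE : ∀ n, trigger n ∈ E ↔ n = 0) : ¬ WSusp D P := by
  rintro ⟨P', hw, hs⟩
  rcases h.race_wtau hbody hB hw with h | ⟨n, hn, ⟨-, h⟩ | ⟨h, -⟩⟩
  · exact h.race_not_susp ((hE 0).2 rfl) hs
  · exact h.not_susp hs
  · exact h ((hE n).1 hn)

end Race

section Bisimilar

variable {L : S.Ident} {hL : S.params L = []}

/-! ### Bisimilar programs -/

/-- A program in which `race hL B` is pending, where `U` contains the values of the emissions that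
it can receive, and where all emissions of the program will be in `G` if it suspends without
receiving further values. -/
def Waiting (hL : S.params L = []) (U : Set ℕ) (G : Set (Emission S)) (P : Program S) : Prop :=
  ∃ B E F, Hosts (race hL B) P E ∧ (∀ u, Inert (B.inst u) F) ∧ (∀ n, trigger n ∈ E ↔ n ∈ U) ∧
    G = E ∪ F

/-- Diverging programs are related to each other. Settling programs are related if they end with
the same emissions, and so are programs in which the race is pending, even if some emissions are
present from the beginning in one of them and a result of the race in the other. -/
inductive RaceRel (hL : S.params L = []) (U : Set ℕ) : Program S → Program S → Prop
  | diverging {P Q : Program S} {E F : Set (Emission S)} :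
      Diverging L E P → Diverging L F Q → RaceRel hL U P Q
  | settling {P Q : Program S} {G : Set (Emission S)} :
      Settling L G P → Settling L G Q → RaceRel hL U P Q
  | waiting {P Q : Program S} {G : Set (Emission S)} :
      Waiting hL U G P → Waiting hL U G Q → RaceRel hL U P Q

variable {U : Set ℕ}

theorem RaceRel.symm {P Q : Program S} (h : RaceRel hL U P Q) : RaceRel hL U Q P := by
  cases h with
  | diverging h₁ h₂ => exact .diverging h₂ h₁
  | settling h₁ h₂ => exact .settling h₂ h₁
  | waiting h₁ h₂ => exact .waiting h₂ h₁

theorem RaceRel.outcome {P Q : Program S} {n : ℕ} {E E' F F' : Set (Emission S)}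
    (hEF : E ∪ F = E' ∪ F') (hP : Outcome L n E F P) (hQ : Outcome L n E' F' Q) :
    RaceRel hL U P Q := by
  rw [Outcome, Set.union_right_comm, hEF, Set.union_right_comm] at hP
  rcases hP with ⟨h, hP⟩ | ⟨h, hP⟩ <;> rcases hQ with ⟨h', hQ⟩ | ⟨h', hQ⟩
  · exact .diverging hP hQ
  · exact absurd h h'
  · exact absurd h' h
  · exact .settling hP hQ

theorem RaceRel.tau (hbody : D.body L = .call L fun _ x => .var x) {P Q P' : Program S}
    (h : RaceRel hL U P Q) (hs : Step D P .tau P') : ∃ Q', WTau D Q Q' ∧ RaceRel hL U P' Q' := by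
  cases h with
  | diverging hP hQ =>
    rcases hP.step hbody hs with ⟨e, -, h, -⟩ | h
    · cases h
    · exact ⟨Q, .refl, .diverging h.2 hQ⟩
  | settling hP hQ =>
    rcases hP.step hs with ⟨e, -, h, -⟩ | h
    · cases h
    · exact ⟨Q, .refl, .settling (.inl h.2) hQ⟩
  | waiting hP hQ =>
    obtain ⟨B, E, F, hP, hB, hU, rfl⟩ := hP
    obtain ⟨B', E', F', hQ, hB', hU', hEF⟩ := hQ
    rcases hP.race_step hB hs with ⟨e, -, h, -⟩ | ⟨n, h | ⟨-, hn⟩, h'⟩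
    · cases h
    · cases h
    · obtain ⟨Q', h₁, h₂⟩ := hQ.race_synch (D := D) hB' ((hU' n).2 ((hU n).1 hn))
      exact ⟨Q', .single h₁, .outcome hEF h' h₂⟩

theorem RaceRel.inp (hbody : D.body L = .call L fun _ x => .var x) {P Q P' : Program S}
    {e : Emission S} (h : RaceRel hL U P Q) (hs : Step D P (.inp e) P') :
    ∃ Q', WStep D Q (.inp e) Q' ∧ RaceRel hL U P' Q' := by
  cases h with
  | diverging hP hQ =>
    rcases hP.step hbody hs with ⟨e, -, h, -⟩ | ⟨h, -⟩ <;> cases h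
  | settling hP hQ =>
    rcases hP.step hs with ⟨e, -, h, -⟩ | ⟨h, -⟩ <;> cases h
  | waiting hP hQ =>
    obtain ⟨B, E, F, hP, hB, hU, rfl⟩ := hP
    obtain ⟨B', E', F', hQ, hB', hU', hEF⟩ := hQ
    rcases hP.race_step hB hs with ⟨e, -, h, -⟩ | ⟨n, h | ⟨h, -⟩, h'⟩
    · cases h
    · cases h
      obtain ⟨Q', h₁, h₂⟩ := hQ.race_inp (D := D) hB' n
      exact ⟨Q', ⟨Q, Q', .refl, h₁, .refl⟩, .outcome hEF h' h₂⟩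
    · cases h

/-- Outputs are matched if they only have to be matched for settling programs. -/
theorem RaceRel.out {susp : Program S → Prop}
    (hd : ∀ E P, Diverging L E P → ¬ susp P) (hw : ∀ G P, Waiting hL U G P → ¬ susp P)
    {P Q P' : Program S} {ts : List S.Name} {e : Emission S} (h : RaceRel hL U P Q)
    (hs : Step D P (.out ts e) P') (hsusp : susp P) :
    ts = [] ∧ P' = P ∧ ∃ Q', WTau D Q Q' ∧ Step D Q' (.out [] e) Q' ∧ RaceRel hL U P Q' := by
  cases h with
  | diverging hP hQ => exact (hd _ _ hP hsusp).elim
  | waiting hP hQ => exact (hw _ _ hP hsusp).elim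
  | settling hP hQ =>
    rcases hP.step hs with ⟨e, he, h, rfl⟩ | ⟨h, -⟩
    · cases h
      obtain ⟨Q', h₁, h₂⟩ := hQ.exists_inert (D := D)
      exact ⟨rfl, rfl, Q', h₁, h₂.out he, .settling hP (.inl h₂)⟩
    · cases h

theorem RaceRel.tick (h0 : 0 ∈ U) {P Q P'' : Program S} {l : List (Emission S)}
    (h : RaceRel hL U P Q) (hsusp : Susp D (withEmissions P l))
    (ht : Tick (withEmissions P l) P'') :
    ∃ Q' Q'', WTau D (withEmissions Q l) Q' ∧ Susp D Q' ∧ RaceRel hL U (withEmissions P l) Q' ∧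
      Tick Q' Q'' ∧ RaceRel hL U P'' Q'' := by
  have hP' := hsusp.of_withEmissions
  cases h with
  | diverging hP hQ => exact (hP.not_susp hP').elim
  | waiting hP hQ =>
    obtain ⟨B, E, F, hP, hB, hU, rfl⟩ := hP
    exact (hP.race_not_susp ((hU 0).2 h0) hP').elim
  | settling hP hQ =>
    have hP := (hP.inert_of_susp hP').withEmissions l
    obtain ⟨Q', h₁, h₂⟩ := hQ.exists_inert (D := D)
    have h₃ := h₂.withEmissions l
    obtain ⟨Q'', h₄⟩ := h₃.exists_tick
    exact ⟨_, Q'', h₁.withEmissions l, h₃.susp, .settling (.inl hP) (.inl h₃), h₄,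
      .settling (.inl (hP.tick ht)) (.inl (h₃.tick h₄))⟩

/-- Since the signal of `trigger` always carries value `0`, a program in which the race is pending
is not suspended, whatever emissions are added to it. -/
theorem RaceRel.isLabelledBisim (hbody : D.body L = .call L fun _ x => .var x) (h0 : 0 ∈ U)
    {susp : Program S → Prop}
    (hd : ∀ E P, Diverging L E P → ¬ susp P) (hw : ∀ G P, Waiting hL U G P → ¬ susp P) :
    IsLabelledBisim D susp (RaceRel hL U) where
  symm _ _ h := h.symm
  tau _ _ _ h hs := h.tau hbody hs
  out P Q P' ts e h hs hsusp _ := by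
    obtain ⟨rfl, rfl, Q', h₁, h₂, h₃⟩ := h.out hd hw hs hsusp
    exact ⟨[], Q', .refl _, ⟨Q', Q', h₁, h₂, .refl⟩, h₃⟩
  inp _ _ _ _ h hs := by
    obtain ⟨Q', h₁, h₂⟩ := h.inp hbody hs
    exact ⟨Q', .inl ⟨h₁, h₂⟩⟩
  tick _ _ _ _ h hsusp ht := h.tick h0 hsusp ht

theorem RaceRel.isBarbedBisim (hbody : D.body L = .call L fun _ x => .var x) (h0 : 0 ∈ U)
    {susp : Program S → Prop}
    (hd : ∀ E P, Diverging L E P → ¬ susp P) (hw : ∀ G P, Waiting hL U G P → ¬ susp P) :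
    IsBarbedBisim D susp (RaceRel hL U) where
  symm _ _ h := h.symm
  tau _ _ _ h hs := h.tau hbody hs
  commit P Q a h hc hsusp := by
    obtain ⟨ts, e, P', rfl, hs⟩ := hc
    obtain ⟨-, -, Q', h₁, h₂, h₃⟩ := h.out hd hw hs hsusp
    exact ⟨Q', h₁, ⟨[], e, Q', rfl, h₂⟩, h₃⟩
  tick _ _ _ h hsusp ht := h.tick (l := []) h0 hsusp ht

theorem Waiting.not_susp (h0 : 0 ∈ U) {G : Set (Emission S)} {P : Program S}
    (h : Waiting hL U G P) : ¬ Susp D P := by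
  obtain ⟨B, E, F, hP, hB, hU, rfl⟩ := h
  exact hP.race_not_susp ((hU 0).2 h0)

theorem Waiting.not_wsusp (hbody : D.body L = .call L fun _ x => .var x)
    {G : Set (Emission S)} {P : Program S} (h : Waiting hL {0} G P) : ¬ WSusp D P := by
  obtain ⟨B, E, F, hP, hB, hU, rfl⟩ := h
  exact hP.race_not_wsusp hbody hB hU

/-- Barbed bisimulations do not see what a thread does with an input that is not offered. -/
theorem race_barbedBisim (susp : Program S → Prop) (B B' : Prog S [S.T₂]) :
    BarbedBisim D susp (race hL B) (race hL B') := by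
  refine ⟨fun P Q => P = Q ∨ (∃ B, P = race hL B) ∧ ∃ B, Q = race hL B, ⟨?_, ?_, ?_, ?_⟩,
    .inr ⟨⟨B, rfl⟩, B', rfl⟩⟩
  · rintro P Q (h | h)
    · exact .inl h.symm
    · exact .inr h.symm
  · rintro P Q P' (rfl | ⟨⟨B, rfl⟩, -⟩) hs
    · exact ⟨P', .single hs, .inl rfl⟩
    · obtain ⟨n, e, h, -⟩ := race_step hs
      cases h
  · rintro P Q a (rfl | ⟨⟨B, rfl⟩, -⟩) hc -
    · exact ⟨P, .refl, hc, .inl rfl⟩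
    · obtain ⟨ts, e, P', -, hs⟩ := hc
      obtain ⟨n, e, h, -⟩ := race_step hs
      cases h
  · rintro P Q P' (rfl | ⟨⟨B, rfl⟩, ⟨B', rfl⟩⟩) hs ht
    · exact ⟨P, P', .refl, hs, .inl rfl, ht, .inl rfl⟩
    · refine ⟨_, P', .refl, ?_, .inr ⟨⟨B, rfl⟩, B', rfl⟩, ?_, .inl rfl⟩
      · rintro ⟨Q, hQ⟩
        obtain ⟨n, e, h, -⟩ := race_step hQ
        cases h
      · obtain ⟨E, V, N, hE, hV⟩ := ht
        cases hE with
        | inp _ _ _ _ _ h => exact ⟨∅, V, ∅, .inp _ _ _ _ _ h, hV⟩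

end Bisimilar

/-! ### A test for both kinds of bisimulation -/

/-- The consequences, common to labelled and barbed bisimulations, by which programs are
distinguished below. -/
structure IsTest (D : Equations S) (susp : Program S → Prop)
    (R : Program S → Program S → Prop) : Prop where
  symm : ∀ P Q, R P Q → R Q P
  tau : ∀ P Q P', R P Q → Step D P .tau P' → ∃ Q', WTau D Q Q' ∧ R P' Q'
  commit : ∀ P Q e, R P Q → Step D P (.out [] e) P → susp P →
    ∃ Q₁ Q₂, WTau D Q Q₁ ∧ Commits D Q₁ e.name ∧
      Relation.ReflTransGen (fun Q Q' => ∃ α, Step D Q α Q') Q₁ Q₂ ∧ R P Q₂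
  suspend : ∀ P Q P'', R P Q → Susp D P → Tick P P'' → ∃ Q', WTau D Q Q' ∧ Susp D Q' ∧ R P Q'

theorem IsLabelledBisim.isTest {susp : Program S → Prop} {R : Program S → Program S → Prop}
    (h : IsLabelledBisim D susp R) : IsTest D susp R where
  symm := h.symm
  tau := h.tau
  commit P Q e hPQ hs hsusp := by
    obtain ⟨ts, Q', hts, ⟨Q₁, Q₂, h₁, h₂, h₃⟩, h₄⟩ :=
      h.out P Q P [] e hPQ hs hsusp (disjoint_mem_nil _)
    exact ⟨Q₁, Q', h₁, ⟨ts, e, Q₂, rfl, h₂⟩,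
      .head ⟨_, h₂⟩ (Relation.ReflTransGen.mono (fun _ _ h => ⟨_, h⟩) _ _ h₃), h₄⟩
  suspend P Q P'' hPQ hs ht := by
    obtain ⟨Q', -, h₁, h₂, h₃, -⟩ := h.tick P Q [] P'' hPQ hs ht
    exact ⟨Q', h₁, h₂, h₃⟩

theorem IsBarbedBisim.isTest {susp : Program S → Prop} {R : Program S → Program S → Prop}
    (h : IsBarbedBisim D susp R) : IsTest D susp R where
  symm := h.symm
  tau := h.tau
  commit P Q e hPQ hs hsusp := by
    obtain ⟨Q', h₁, h₂, h₃⟩ := h.commit P Q e.name hPQ ⟨[], e, P, rfl, hs⟩ hsusp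
    exact ⟨Q', Q', h₁, h₂, .refl, h₃⟩
  suspend P Q P'' hPQ hs ht := by
    obtain ⟨Q', -, h₁, h₂, h₃, -⟩ := h.tick P Q P'' hPQ hs ht
    exact ⟨Q', h₁, h₂, h₃⟩

section Distinguish

variable {susp : Program S → Prop} {R : Program S → Program S → Prop}

theorem IsTest.wtau (hR : IsTest D susp R) {P P' Q : Program S} (h : R P Q)
    (hs : WTau D P P') : ∃ Q', WTau D Q Q' ∧ R P' Q' := by
  induction hs with
  | refl => exact ⟨Q, .refl, h⟩
  | tail _ hs ih =>
    obtain ⟨Q₁, h₁, h₂⟩ := ih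
    obtain ⟨Q₂, h₃, h₄⟩ := hR.tau _ _ _ h₂ hs
    exact ⟨Q₂, h₁.trans h₃, h₄⟩

theorem IsTest.suspend_of_wtau (hR : IsTest D susp R) {P P' Q : Program S}
    {E : Set (Emission S)} (h : R P Q) (hs : WTau D P P') (hP' : Inert P' E) :
    ∃ Q', WTau D Q Q' ∧ Susp D Q' ∧ R P' Q' := by
  obtain ⟨Q₁, h₁, h₂⟩ := hR.wtau h hs
  obtain ⟨P'', ht⟩ := hP'.exists_tick
  obtain ⟨Q', h₃, h₄, h₅⟩ := hR.suspend _ _ _ h₂ hP'.susp ht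
  exact ⟨Q', h₁.trans h₃, h₄, h₅⟩

theorem IsTest.wsusp (hR : IsTest D susp R) {P P' Q : Program S} {E : Set (Emission S)}
    (h : R P Q) (hs : WTau D P P') (hP' : Inert P' E) : WSusp D Q := by
  obtain ⟨Q', h₁, h₂, -⟩ := hR.suspend_of_wtau h hs hP'
  exact ⟨Q', h₁, h₂⟩

end Distinguish

/-! ### Distinguishing programs -/

theorem Inert.not_commits {P : Program S} {E : Set (Emission S)} {a : S.Name} (h : Inert P E)
    (ha : ∀ e ∈ E, e.name ≠ a) : ¬ Commits D P a := by
  rintro ⟨ts, e, P', he, hs⟩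
  obtain ⟨e', he', h, -⟩ := h.step hs
  cases h
  exact ha _ he' he

section Distinguish

variable {L : S.Ident} {hL : S.params L = []}
  {susp : Program S → Prop} {R : Program S → Program S → Prop}

theorem Diverging.not_commits (hbody : D.body L = .call L fun _ x => .var x)
    {P : Program S} {E : Set (Emission S)} {a : S.Name} (h : Diverging L E P)
    (ha : ∀ e ∈ E, e.name ≠ a) : ¬ Commits D P a := by
  rintro ⟨ts, e, P', he, hs⟩
  rcases h.step hbody hs with ⟨e', he', h, -⟩ | ⟨h, -⟩ <;> cases h
  exact ha _ he' he

theorem Settling.not_commits {P : Program S} {G : Set (Emission S)} {a : S.Name}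
    (h : Settling L G P) (ha : ∀ e ∈ G, e.name ≠ a) : ¬ Commits D P a := by
  rintro ⟨ts, e, P', he, hs⟩
  rcases h.step hs with ⟨e', he', h, -⟩ | ⟨h, -⟩ <;> cases h
  exact ha _ he' he

theorem Settling.reach {G : Set (Emission S)} {P P' : Program S} (h : Settling L G P)
    (hs : Relation.ReflTransGen (fun Q Q' => ∃ α, Step D Q α Q') P P') : Settling L G P' := by
  induction hs with
  | refl => exact h
  | tail _ hs ih =>
    obtain ⟨α, hs⟩ := hs
    rcases ih.step hs with ⟨e, -, -, rfl⟩ | h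
    · exact ih
    · exact .inl h.2

theorem trigger_name_ne (n : ℕ) : (trigger n : Emission S).name ≠ sigName := by
  simp [trigger, sigName, Emission.name]

theorem trigger_name_ne_echo (m n : ℕ) :
    (trigger m : Emission S).name ≠ (echo n : Emission S).name := by
  simp [trigger, echo, Emission.name]

theorem signal_name_ne_echo (m n : ℕ) :
    (signal m : Emission S).name ≠ (echo n : Emission S).name := by
  simp [signal, echo, Emission.name]

section

variable {B B' : Prog S [S.T₂]} {F F' E E' : Set (Emission S)} {P Q : Program S}

theorem Hosts.race_not_commits (hB : ∀ u, Inert (B.inst u) F) {a : S.Name}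
    (h : Hosts (race hL B) P E) (ha : ∀ e ∈ E, e.name ≠ a) : ¬ Commits D P a := by
  rintro ⟨ts, e, P', he, hs⟩
  rcases h.race_step hB hs with ⟨e', he', h, -⟩ | ⟨n, h | ⟨h, -⟩, -⟩ <;> cases h
  exact ha _ he' he

theorem Hosts.race_settle (hB : ∀ u, Inert (B.inst u) F) (h : Hosts (race hL B) P E)
    (h1 : trigger 1 ∈ E) : ∃ P', WTau D P P' ∧ Inert P' (E ∪ {trigger 1} ∪ F) := by
  obtain ⟨P₁, hs, ⟨h, -⟩ | ⟨-, h⟩⟩ := h.race_synch (D := D) hB h1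
  · cases h
  · obtain ⟨P', hw, hi⟩ := h.exists_inert (D := D)
    exact ⟨P', .head hs hw, hi⟩

theorem Hosts.race_diverge (hB : ∀ u, Inert (B.inst u) F) (h : Hosts (race hL B) P E)
    (h0 : trigger 0 ∈ E) : ∃ P', Step D P .tau P' ∧ Diverging L (E ∪ {trigger 0}) P' := by
  obtain ⟨P', hs, ⟨-, h⟩ | ⟨h, -⟩⟩ := h.race_synch (D := D) hB h0
  · exact ⟨P', hs, h⟩
  · exact absurd rfl h

/-- If the race is lost internally but an input can decide it, then L-suspension makes the
emissions visible that are present from the beginning. -/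
theorem IsTest.false_of_lsusp (hR : IsTest D (LSusp D) R)
    (hbody : D.body L = .call L fun _ x => .var x)
    (hB : ∀ u, Inert (B.inst u) F) (hB' : ∀ u, Inert (B'.inst u) F')
    (hP : Hosts (race hL B) P E) (hQ : Hosts (race hL B') Q E')
    (hE : signal 0 ∈ E) (hE' : ∀ e ∈ E', e.name ≠ sigName)
    (ht : ∀ n, trigger n ∈ E' ↔ n = 0) (h : R P Q) : False := by
  have hsusp : LSusp D P := by
    obtain ⟨P₁, hs, ⟨h, -⟩ | ⟨-, h⟩⟩ := hP.race_inp (D := D) hB 1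
    · cases h
    · obtain ⟨P', hw, hi⟩ := h.exists_inert (D := D)
      exact ⟨P', .head ⟨_, hs⟩ (Relation.ReflTransGen.mono (fun _ _ h => ⟨_, h⟩) _ _ hw), hi.susp⟩
  obtain ⟨Q₁, -, hw, hc, -⟩ := hR.commit P Q _ h (hP.out hE) hsusp
  rcases hQ.race_wtau hbody hB' hw with h | ⟨n, hn, ⟨-, h⟩ | ⟨h, -⟩⟩
  · exact h.race_not_commits hB' hE' hc
  · refine h.not_commits hbody ?_ hc
    rintro e (he | rfl)
    · exact hE' e he
    · exact trigger_name_ne 0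
  · exact h ((ht n).1 hn)

/-- If the race can be won and lost, then weak suspension makes the emissions visible that are
present from the beginning, whereas the emissions that result from the race come too late. -/
theorem IsTest.false_of_wsusp (hR : IsTest D (WSusp D) R)
    (hbody : D.body L = .call L fun _ x => .var x)
    (hB : ∀ u, Inert (B.inst u) F) (hB' : ∀ u, Inert (B'.inst u) F')
    (hP : Hosts (race hL B) P E) (hQ : Hosts (race hL B') Q E')
    (h0 : trigger 0 ∈ E) (h1 : trigger 1 ∈ E)
    (hE : signal 0 ∈ E) (hE' : ∀ e ∈ E', e.name ≠ sigName) (h : R P Q) : False := by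
  have hsusp : WSusp D P := by
    obtain ⟨P', hw, hi⟩ := hP.race_settle (D := D) hB h1
    exact ⟨P', hw, hi.susp⟩
  obtain ⟨Q₁, Q₂, hw, hc, hw₂, h₂⟩ := hR.commit P Q _ h (hP.out hE) hsusp
  rcases hQ.race_wtau hbody hB' hw with h | ⟨n, hn, ⟨-, h⟩ | ⟨-, h⟩⟩
  · exact h.race_not_commits hB' hE' hc
  · refine h.not_commits hbody ?_ hc
    rintro e (he | rfl)
    · exact hE' e he
    · exact trigger_name_ne 0
  · obtain ⟨P', hs, hP'⟩ := hP.race_diverge (D := D) hB h0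
    obtain ⟨Q₃, h₃, h₄⟩ := hR.tau _ _ _ h₂ hs
    have hQ₃ := (h.reach hw₂).reach (Relation.ReflTransGen.mono (fun _ _ h => ⟨_, h⟩) _ _ h₃)
    obtain ⟨Q₄, h₅, h₆⟩ := hQ₃.exists_inert (D := D)
    exact hP'.not_wsusp hbody (hR.wsusp (hR.symm _ _ h₄) h₅ h₆)

/-- The results of the race are visible if it can be won. -/
theorem IsTest.false_of_result (hR : IsTest D susp R) (hsusp : ∀ P, Susp D P → susp P)
    (hbody : D.body L = .call L fun _ x => .var x)
    (hB : ∀ u, Inert (B.inst u) F) (hB' : ∀ u, Inert (B'.inst u) F')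
    (hP : Hosts (race hL B) P E) (hQ : Hosts (race hL B') Q E')
    (h1 : trigger 1 ∈ E) (hF : signal 0 ∈ F) (hE' : ∀ e ∈ E', e.name ≠ sigName)
    (hF' : ∀ e ∈ F', e.name ≠ sigName) (h : R P Q) : False := by
  obtain ⟨P', hw, hi⟩ := hP.race_settle (D := D) hB h1
  obtain ⟨Q₁, hw₁, -, h₁⟩ := hR.suspend_of_wtau h hw hi
  obtain ⟨Q₂, -, hw₂, hc, -⟩ := hR.commit _ _ _ h₁ (hi.out (.inr hF)) (hsusp _ hi.susp)
  rcases hQ.race_wtau hbody hB' (hw₁.trans hw₂) with h | ⟨n, hn, ⟨-, h⟩ | ⟨-, h⟩⟩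
  · exact h.race_not_commits hB' hE' hc
  · refine h.not_commits hbody ?_ hc
    rintro e (he | rfl)
    · exact hE' e he
    · exact trigger_name_ne 0
  · refine h.not_commits ?_ hc
    rintro e ((he | rfl) | he)
    · exact hE' e he
    · exact trigger_name_ne n
    · exact hF' e he

/-! ### A thread that relays the observed value -/

/-- The thread that reads a value on the observed signal and emits on this value. -/
def relay (hL : S.params L = []) : Program S :=
  .present (t := S.T₂) (.name 1) (.emit (t := S.T₁) (.var .zero) (.name 0)) L (noArgs hL)

theorem relay_step {α : Act S} {P' : Program S} (h : Step D (relay hL) α P') :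
    ∃ n, α = .inp (signal n) ∧ Inert P' ({echo n} ∪ {signal n}) := by
  cases h with
  | inp s v =>
    obtain ⟨n, rfl⟩ := Val.eq_name v
    exact ⟨n, rfl, .par (.emit n (.name 0)) (.emit 1 (.name n))⟩

theorem relay_synch {n : ℕ} (h : Step D P (.out [] (signal n)) P) :
    ∃ R, Step D (.par P (relay hL)) .tau (.par P R) ∧ Inert R ({echo n} ∪ {signal n}) :=
  ⟨_, .synchL h (.inp 1 _ _ _ _) (disjoint_mem_nil _),
    .par (.emit n (.name 0)) (.emit 1 (.name n))⟩

theorem par_relay_tau {P' : Program S} (h : Step D (.par P (relay hL)) .tau P') :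
    (∃ P₁, Step D P .tau P₁ ∧ P' = .par P₁ (relay hL)) ∨ Commits D P sigName := by
  cases h with
  | parL h _ => exact .inl ⟨_, h, rfl⟩
  | parR h _ => obtain ⟨n, h, -⟩ := relay_step h; cases h
  | synchR _ h _ => obtain ⟨n, h, -⟩ := relay_step h; cases h
  | synchL h h' _ =>
    obtain ⟨n, h', -⟩ := relay_step h'
    cases h'
    exact .inr ⟨_, _, _, rfl, h⟩

/-- A settling program in parallel with the relay, before or after the latter has received a
value. -/
def SettlingRelay (hL : S.params L = []) (G : Set (Emission S)) (P : Program S) : Prop :=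
  ∃ P₁ P₂, P = .par P₁ P₂ ∧ Settling L G P₁ ∧ (P₂ = relay hL ∨ ∃ H, Inert P₂ H)

theorem SettlingRelay.tau {G : Set (Emission S)} {P' : Program S} (h : SettlingRelay hL G P)
    (hs : Step D P .tau P') : SettlingRelay hL G P' := by
  obtain ⟨P₁, P₂, rfl, h₁, h₂⟩ := h
  have hinp : ∀ e P₁', ¬ Step D P₁ (.inp e) P₁' := fun e P₁' h => by
    rcases h₁.step h with ⟨_, -, h, -⟩ | ⟨h, -⟩ <;> cases h
  cases hs with
  | parL h _ =>
    rcases h₁.step h with ⟨_, -, h, -⟩ | ⟨-, h⟩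
    · cases h
    · exact ⟨_, P₂, rfl, .inl h, h₂⟩
  | parR h _ =>
    rcases h₂ with rfl | ⟨H, h₂⟩
    · obtain ⟨n, h, -⟩ := relay_step h; cases h
    · exact (h₂.susp ⟨_, h⟩).elim
  | synchR h _ _ => exact (hinp _ _ h).elim
  | synchL h h' _ =>
    obtain ⟨e, -, he, rfl⟩ := (h₁.step h).resolve_right fun h => nomatch h.1
    cases he
    rcases h₂ with rfl | ⟨H, h₂⟩
    · obtain ⟨n, -, h⟩ := relay_step h'
      exact ⟨_, _, rfl, h₁, .inr ⟨_, h⟩⟩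
    · obtain ⟨_, -, h, -⟩ := h₂.step h'; cases h

theorem SettlingRelay.exists_inert {G : Set (Emission S)} (h : SettlingRelay hL G P)
    {n : ℕ} (hG : signal n ∈ G) : ∃ P' H, WTau D P P' ∧ Inert P' H := by
  obtain ⟨P₁, P₂, rfl, h₁, h₂⟩ := h
  obtain ⟨P₁', hw, hi⟩ := h₁.exists_inert (D := D)
  rcases h₂ with rfl | ⟨H, h₂⟩
  · obtain ⟨R, hs, hR⟩ := relay_synch (hL := hL) (hi.out (D := D) hG)
    exact ⟨_, _, (hw.par _).tail hs, hi.par hR⟩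
  · exact ⟨_, _, hw.par _, hi.par h₂⟩

/-- The internal derivatives of the race in parallel with the relay, if there is nothing to relay
before the race is decided. -/
theorem Hosts.race_relay_wtau (hbody : D.body L = .call L fun _ x => .var x)
    (hB : ∀ u, Inert (B.inst u) F) (hP : Hosts (race hL B) P E)
    (hE : ∀ e ∈ E, e.name ≠ sigName) {P' : Program S}
    (hs : WTau D (.par P (relay hL)) P') :
    (∃ P₁, P' = .par P₁ (relay hL) ∧ Hosts (race hL B) P₁ E) ∨
      (∃ P₁, P' = .par P₁ (relay hL) ∧ Diverging L (E ∪ {trigger 0}) P₁) ∨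
      ∃ n, SettlingRelay hL (E ∪ {trigger n} ∪ F) P' := by
  induction hs with
  | refl => exact .inl ⟨P, rfl, hP⟩
  | tail _ hs ih =>
    rcases ih with ⟨P₁, rfl, h⟩ | ⟨P₁, rfl, h⟩ | ⟨n, h⟩
    · rcases par_relay_tau hs with ⟨P₂, hs₂, rfl⟩ | hc
      · rcases h.race_step hB hs₂ with ⟨e, -, h, -⟩ | ⟨n, -, ⟨rfl, h⟩ | ⟨-, h⟩⟩
        · cases h
        · exact .inr (.inl ⟨P₂, rfl, h⟩)
        · exact .inr (.inr ⟨n, P₂, _, rfl, h, .inl rfl⟩)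
      · exact (h.race_not_commits hB hE hc).elim
    · rcases par_relay_tau hs with ⟨P₂, hs₂, rfl⟩ | hc
      · rcases h.step hbody hs₂ with ⟨e, -, h, -⟩ | ⟨-, h⟩
        · cases h
        · exact .inr (.inl ⟨P₂, rfl, h⟩)
      · refine (h.not_commits hbody ?_ hc).elim
        rintro e (he | rfl)
        · exact hE e he
        · exact trigger_name_ne 0
    · exact .inr (.inr ⟨n, h.tau hs⟩)

theorem Diverging.par_relay_not_wsusp (hbody : D.body L = .call L fun _ x => .var x)
    (hE : ∀ e ∈ E, e.name ≠ sigName) (h : Diverging L E P) :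
    ¬ WSusp D (.par P (relay hL)) := by
  refine not_wsusp_of_invariant
    (I := fun P => ∃ P₁, P = .par P₁ (relay hL) ∧ Diverging L E P₁) ?_ ?_ ⟨P, rfl, h⟩
  · rintro _ P' ⟨P₁, rfl, h⟩ hs
    rcases par_relay_tau hs with ⟨P₂, hs₂, rfl⟩ | hc
    · rcases h.step hbody hs₂ with ⟨e, -, h, -⟩ | ⟨-, h⟩
      · cases h
      · exact ⟨P₂, rfl, h⟩
    · exact (h.not_commits hbody hE hc).elim
  · rintro _ ⟨P₁, rfl, h⟩ hs
    exact h.not_susp fun ⟨P', h'⟩ => hs ⟨_, .parL h' (Set.empty_disjoint _)⟩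

/-- The relay distinguishes emissions that are present from the beginning from those that result
from the race: the former can be relayed while the race is undecided. After `P` has relayed value
`0`, it can still diverge, and it can still suspend, but then it has relayed value `0`. No
derivative of `Q` combines these properties. -/
theorem IsTest.false_of_relay (hR : IsTest D (Susp D) R)
    (hbody : D.body L = .call L fun _ x => .var x)
    (hB : ∀ u, Inert (B.inst u) F) (hB' : ∀ u, Inert (B'.inst u) F')
    (hP : Hosts (race hL B) P E) (hQ : Hosts (race hL B') Q E')
    (h0 : trigger 0 ∈ E) (h1 : trigger 1 ∈ E) (hE : signal 0 ∈ E)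
    (h1' : trigger 1 ∈ E') (hF' : signal 1 ∈ F') (hE' : ∀ e ∈ E', e.name ≠ sigName)
    (hEe : ∀ e ∈ E', e.name ≠ (echo 0 : Emission S).name)
    (hFe : ∀ e ∈ F', e.name ≠ (echo 0 : Emission S).name)
    (h : R (.par P (relay hL)) (.par Q (relay hL))) : False := by
  obtain ⟨T, hs, hT⟩ := relay_synch (hL := hL) (hP.out (D := D) hE)
  have hX := hP.parL hT
  obtain ⟨Y, hY, h⟩ := hR.tau _ _ _ h hs
  rcases hQ.race_relay_wtau hbody hB' hE' hY with ⟨Y₁, rfl, hY₁⟩ | ⟨Y₁, rfl, hY₁⟩ | ⟨n, hY₁⟩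
  · -- The race is undecided: `Q` can win it and relay value `1` instead of value `0`.
    obtain ⟨Y₂, hw, hi⟩ := hY₁.race_settle (D := D) hB' h1'
    obtain ⟨T', hs', hT'⟩ := relay_synch (hL := hL) (hi.out (D := D) (.inr hF'))
    have hi' := hi.par hT'
    obtain ⟨X, hwX, hsX, hX'⟩ := hR.suspend_of_wtau (hR.symm _ _ h) ((hw.par _).tail hs') hi'
    rcases hX.race_wtau hbody hB hwX with h | ⟨n, -, ⟨-, h⟩ | ⟨-, h⟩⟩
    · exact h.race_not_susp (.inl h0) hsX
    · exact h.not_susp hsX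
    · have hX₃ := h.inert_of_susp hsX
      obtain ⟨Q₁, -, hw₁, hc, -⟩ := hR.commit _ _ (echo 0) (hR.symm _ _ hX')
        (hX₃.out (.inl (.inl (.inr (.inl rfl))))) hsX
      obtain rfl := hi'.wtau hw₁
      refine hi'.not_commits ?_ hc
      rintro e (((he | rfl) | he) | rfl | rfl)
      · exact hEe e he
      · exact trigger_name_ne_echo 1 0
      · exact hFe e he
      · simp [echo, Emission.name]
      · exact signal_name_ne_echo 1 0
  · -- The race is lost: `Q` cannot suspend any more.
    obtain ⟨X, hw, hi⟩ := hX.race_settle (D := D) hB (.inl h1)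
    refine hY₁.par_relay_not_wsusp hbody ?_ (hR.wsusp h hw hi)
    rintro e (he | rfl)
    · exact hE' e he
    · exact trigger_name_ne 0
  · -- The race is won: `Q` cannot diverge any more.
    obtain ⟨X, hs, hD⟩ := hX.race_diverge (D := D) hB (.inl h0)
    obtain ⟨Y', hw, h'⟩ := hR.tau _ _ _ h hs
    have hY' : SettlingRelay hL (E' ∪ {trigger n} ∪ F') Y' := by
      clear h'
      induction hw with
      | refl => exact hY₁
      | tail _ hs ih => exact ih.tau hs
    obtain ⟨Z, H, hw', hi⟩ := hY'.exists_inert (D := D) (.inr hF')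
    exact hD.not_wsusp hbody (hR.wsusp (hR.symm _ _ h') hw' hi)

end

end Distinguish

/-! ### The counterexamples -/

/-- Both values are emitted on the observed signal. -/
def both {Γ : S.Cx} : Prog S Γ :=
  .par (.emit (t := S.T₂) (.name 1) (.name 0)) (.emit (t := S.T₂) (.name 1) (.name 1))

theorem both_inst (u : Val S S.T₂) :
    Inert (both.inst u : Program S) ({signal 0} ∪ {signal 1}) :=
  .par (.emit 1 (.name 0)) (.emit 1 (.name 1))

theorem zero_inst (u : Val S S.T₂) : Inert ((.zero : Prog S [S.T₂]).inst u) ∅ := .zero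

section

variable {L : S.Ident} (hL : S.params L = [])

/-- The observed signal is emitted from the beginning. -/
def early : Program S := .par (.par (trigger 0).prog both) (race hL .zero)

/-- The observed signal is emitted as a result of the race. -/
def late : Program S := .par (trigger 0).prog (race hL both)

/-- The emissions of `early hL`. -/
def earlySet : Set (Emission S) := {trigger 0} ∪ ({signal 0} ∪ {signal 1})

theorem early_hosts : Hosts (race hL .zero) (early hL) earlySet := by
  rw [← Set.union_empty earlySet]
  exact .parR (.par (.emit 0 (.name 0)) (both_inst (.name 0))) .here

theorem late_hosts : Hosts (race hL both) (late hL) {trigger 0} := by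
  rw [← Set.union_empty {trigger 0}]
  exact .parR (.emit 0 (.name 0)) .here

theorem par_trigger_hosts {ℓ P : Program S} {E : Set (Emission S)} (h : Hosts ℓ P E) :
    Hosts ℓ (.par P (trigger 1).prog) (E ∪ {trigger 1}) :=
  h.parL (.emit 0 (.name 1))

theorem early_late : RaceRel hL {0} (early hL) (late hL) :=
  .waiting ⟨_, _, _, early_hosts hL, zero_inst,
      by simp [earlySet, trigger, signal], (Set.union_empty _).symm⟩
    ⟨_, _, _, late_hosts hL, both_inst, by simp [trigger], rfl⟩

theorem early_late_par : RaceRel hL {1, 0} (.par (early hL) (trigger 1).prog)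
    (.par (late hL) (trigger 1).prog) :=
  .waiting ⟨_, _, _, par_trigger_hosts (early_hosts hL), zero_inst,
      by simp [earlySet, trigger, signal], (Set.union_empty _).symm⟩
    ⟨_, _, _, par_trigger_hosts (late_hosts hL), both_inst, by simp [trigger], by
      rw [earlySet, Set.union_right_comm]⟩

end

/-! ### Comparison of the bisimulations -/

theorem IsLabelledBisim.anti {susp susp' : Program S → Prop} (h : ∀ P, susp' P → susp P)
    {R : Program S → Program S → Prop} (hR : IsLabelledBisim D susp R) :
    IsLabelledBisim D susp' R :=
  { hR with out := fun P Q P' ts e hPQ hs hsusp => hR.out P Q P' ts e hPQ hs (h P hsusp) }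

theorem IsBarbedBisim.anti {susp susp' : Program S → Prop} (h : ∀ P, susp' P → susp P)
    {R : Program S → Program S → Prop} (hR : IsBarbedBisim D susp R) :
    IsBarbedBisim D susp' R :=
  { hR with commit := fun P Q a hPQ hc hsusp => hR.commit P Q a hPQ hc (h P hsusp) }

theorem LabelledBisim.anti {susp susp' : Program S → Prop} (h : ∀ P, susp' P → susp P) :
    LabelledBisim D susp ≤ LabelledBisim D susp' :=
  fun _ _ ⟨R, hR, hPQ⟩ => ⟨R, hR.anti h, hPQ⟩

theorem BarbedBisim.anti {susp susp' : Program S → Prop} (h : ∀ P, susp' P → susp P) :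
    BarbedBisim D susp ≤ BarbedBisim D susp' :=
  fun _ _ ⟨R, hR, hPQ⟩ => ⟨R, hR.anti h, hPQ⟩

theorem ContextualBisim.anti {susp susp' : Program S → Prop} (h : ∀ P, susp' P → susp P) :
    ContextualBisim D susp ≤ ContextualBisim D susp' :=
  fun _ _ ⟨R, hR, hPQ⟩ => ⟨R, ⟨hR.barbed.anti h, hR.ctx⟩, hPQ⟩

section

variable {L : S.Ident} {hL : S.params L = []}

theorem IsTest.not_early_late {R : Program S → Program S → Prop} (hR : IsTest D (LSusp D) R)
    (hbody : D.body L = .call L fun _ x => .var x) : ¬ R (early hL) (late hL) :=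
  hR.false_of_lsusp hbody zero_inst both_inst (early_hosts hL) (late_hosts hL)
    (by simp [earlySet]) (by simp [trigger_name_ne]) (by simp [trigger])

theorem IsTest.not_early_late_par {R : Program S → Program S → Prop} (hR : IsTest D (WSusp D) R)
    (hbody : D.body L = .call L fun _ x => .var x) :
    ¬ R (.par (early hL) (trigger 1).prog) (.par (late hL) (trigger 1).prog) :=
  hR.false_of_wsusp hbody zero_inst both_inst (par_trigger_hosts (early_hosts hL))
    (par_trigger_hosts (late_hosts hL)) (by simp [earlySet]) (by simp) (by simp [earlySet])
    (by simp [trigger_name_ne])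

theorem IsTest.not_early_late_relay {R : Program S → Program S → Prop} (hR : IsTest D (Susp D) R)
    (hbody : D.body L = .call L fun _ x => .var x) :
    ¬ R (.par (.par (early hL) (trigger 1).prog) (relay hL))
      (.par (.par (late hL) (trigger 1).prog) (relay hL)) :=
  hR.false_of_relay hbody zero_inst both_inst (par_trigger_hosts (early_hosts hL))
    (par_trigger_hosts (late_hosts hL)) (by simp [earlySet]) (by simp) (by simp [earlySet])
    (by simp) (by simp) (by simp [trigger_name_ne]) (by simp [trigger_name_ne_echo])
    (by simp [signal_name_ne_echo])

theorem not_preservedByPar_barbedBisim (hL : S.params L = [])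
    (hbody : D.body L = .call L fun _ x => .var x) {susp : Program S → Prop}
    (hsusp : ∀ P, Susp D P → susp P) : ¬ PreservedByPar (BarbedBisim D susp) := by
  intro h
  obtain ⟨R, hR, hPQ⟩ := h _ _ (trigger 1).prog (race_barbedBisim (hL := hL) susp both .zero)
  exact hR.isTest.false_of_result hsusp hbody both_inst zero_inst (par_trigger_hosts .here)
    (par_trigger_hosts .here) (by simp) (by simp) (by simp [trigger_name_ne]) (by simp) hPQ

end

end SPi

theorem mainTheorem4 (S : SPi.Signature) (D : SPi.Equations S)
    (hzero : ∃ A : S.Ident, S.params A = [] ∧ D.body A = .zero)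
    (hloop : ∃ A : S.Ident, S.params A = [] ∧ D.body A = .call A (fun _ x => .var x)) :
    ((SPi.BarbedBisim D (SPi.LSusp D) < SPi.BarbedBisim D (SPi.WSusp D) ∧
        SPi.BarbedBisim D (SPi.WSusp D) < SPi.BarbedBisim D (SPi.Susp D)) ∧
      (SPi.LabelledBisim D (SPi.LSusp D) < SPi.LabelledBisim D (SPi.WSusp D) ∧
        SPi.LabelledBisim D (SPi.WSusp D) < SPi.LabelledBisim D (SPi.Susp D)) ∧
      (SPi.ContextualBisim D (SPi.LSusp D) ≤ SPi.ContextualBisim D (SPi.WSusp D) ∧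
        SPi.ContextualBisim D (SPi.WSusp D) ≤ SPi.ContextualBisim D (SPi.Susp D))) ∧
    ((¬ SPi.PreservedByPar (SPi.BarbedBisim D (SPi.LSusp D)) ∧
        ¬ SPi.PreservedByPar (SPi.BarbedBisim D (SPi.WSusp D)) ∧
        ¬ SPi.PreservedByPar (SPi.BarbedBisim D (SPi.Susp D))) ∧
      ¬ SPi.PreservedByPar (SPi.LabelledBisim D (SPi.WSusp D)) ∧
      ¬ SPi.PreservedByPar (SPi.LabelledBisim D (SPi.Susp D))) := by
  open SPi in
  obtain ⟨L, hL, hbody⟩ := hloop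
  have hsw : ∀ P, Susp D P → WSusp D P := fun _ => Susp.wsusp
  have hwl : ∀ P, WSusp D P → LSusp D P := fun _ => WSusp.lsusp
  have hd : ∀ E P, Diverging L E P → ¬ WSusp D P := fun _ _ h => h.not_wsusp hbody
  have hw : ∀ G P, Waiting hL {0} G P → ¬ WSusp D P := fun _ _ h => h.not_wsusp hbody
  have hd' : ∀ E P, Diverging L E P → ¬ Susp D P := fun _ _ h => h.not_susp
  have hw' : ∀ G P, Waiting hL {1, 0} G P → ¬ Susp D P := fun _ _ h => h.not_susp (by simp)
  have hLw : LabelledBisim D (WSusp D) (early hL) (late hL) :=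
    ⟨_, RaceRel.isLabelledBisim hbody (by simp) hd hw, early_late hL⟩
  have hBw : BarbedBisim D (WSusp D) (early hL) (late hL) :=
    ⟨_, RaceRel.isBarbedBisim hbody (by simp) hd hw, early_late hL⟩
  have hLs : LabelledBisim D (Susp D) (.par (early hL) (trigger 1).prog)
      (.par (late hL) (trigger 1).prog) :=
    ⟨_, RaceRel.isLabelledBisim hbody (by simp) hd' hw', early_late_par hL⟩
  have hBs : BarbedBisim D (Susp D) (.par (early hL) (trigger 1).prog)
      (.par (late hL) (trigger 1).prog) :=
    ⟨_, RaceRel.isBarbedBisim hbody (by simp) hd' hw', early_late_par hL⟩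
  refine ⟨⟨⟨lt_of_le_not_ge (BarbedBisim.anti hwl) fun h => ?_,
      lt_of_le_not_ge (BarbedBisim.anti hsw) fun h => ?_⟩,
    ⟨lt_of_le_not_ge (LabelledBisim.anti hwl) fun h => ?_,
      lt_of_le_not_ge (LabelledBisim.anti hsw) fun h => ?_⟩,
    ContextualBisim.anti hwl, ContextualBisim.anti hsw⟩,
    ⟨not_preservedByPar_barbedBisim hL hbody fun P h => hwl P (hsw P h),
      not_preservedByPar_barbedBisim hL hbody hsw,
      not_preservedByPar_barbedBisim hL hbody fun _ h => h⟩, fun h => ?_, fun h => ?_⟩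
  · obtain ⟨R, hR, hPQ⟩ := h _ _ hBw
    exact hR.isTest.not_early_late hbody hPQ
  · obtain ⟨R, hR, hPQ⟩ := h _ _ hBs
    exact hR.isTest.not_early_late_par hbody hPQ
  · obtain ⟨R, hR, hPQ⟩ := h _ _ hLw
    exact hR.isTest.not_early_late hbody hPQ
  · obtain ⟨R, hR, hPQ⟩ := h _ _ hLs
    exact hR.isTest.not_early_late_par hbody hPQ
  · obtain ⟨R, hR, hPQ⟩ := h _ _ (trigger 1).prog hLw
    exact hR.isTest.not_early_late_par hbody hPQ
  · obtain ⟨R, hR, hPQ⟩ := h _ _ (relay hL) hLs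
    exact hR.isTest.not_early_late_relay hbody hPQ
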